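/- An index is a tuple $\mathbf{k}=(k_1,\ldots,k_n)$ of positive integers; its weight is $k_1+\cdots+k_n$, its depth is $n$, and its height is $|\{j : k_j\ge 2\}|$. It is admissible if $n\ge1$ and $k_n\ge 2$. Let $I_0(k,n,s)$ be the (finite) set of admissible indices of weight $k$, depth $n$ and height $s$. For an admissible index $\mathbf{k}=(k_1,\ldots,k_n)$ the multiple $T$-value is $$T(\mathbf{k})=2^{n}\sum_{\substack{0<m_1<\cdots<m_n\\ m_i\equiv i \bmod 2\ \text{for all } i}}\frac{1}{m_1^{k_1}\cdots m_n^{k_n}} .$$ **Theorem 1.1.** The series defining $T(\mathbf{k})$ converges for every admissible index $\mathbf{k}$, and $$1-\sum_{k>n\ge 1}\left(\sum_{s=1}^{n}\frac{1}{2^{s}}\sum_{\mathbf{k}\in I_0(k,n,s)}T(\mathbf{k})\right)x^{k-n}y^{n}=\exp\left(\sum_{n\ge 2}\frac{T(n)}{2n}\bigl(x^{n}+y^{n}-(x+y)^{n}\bigr)\right).$$ This identity holds in the ring $\mathbb{R}[[x,y]]$ of formal power series. It also holds for all complex numbers $x,y$ with $|x|<1/2$ and $|y|<1/4$, where the double series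 on the left and the series in the exponent on the right both converge absolutely. -/

import Mathlib

namespace MultipleT

/-- A tuple `(k_1, …, k_n)` is an index if all its entries are positive integers.
The entry `k_{j+1}` is `κ j` for `j : Fin n`. -/
def IsIndex {n : ℕ} (κ : Fin n → ℕ) : Prop := ∀ j, 1 ≤ κ j

/-- The weight `k_1 + ⋯ + k_n`. -/
def weight {n : ℕ} (κ : Fin n → ℕ) : ℕ := ∑ j, κ j

/-- The height `|{j | k_j ≥ 2}|`. -/
def height {n : ℕ} (κ : Fin n → ℕ) : ℕ := (Finset.univ.filter fun j => 2 ≤ κ j).card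

/-- The last entry exists and is at least two. -/
def IsAdmissible {n : ℕ} (κ : Fin n → ℕ) : Prop := ∃ j : Fin n, (j : ℕ) + 1 = n ∧ 2 ≤ κ j

open Classical in
/-- The set `I(k, n, s)` of indices of weight `k`, depth `n` and height `s`. -/
noncomputable def indices (k n s : ℕ) : Finset (Fin n → ℕ) :=
  (Finset.piAntidiag Finset.univ k).filter fun κ => IsIndex κ ∧ height κ = s

theorem mem_indices {k n s : ℕ} {κ : Fin n → ℕ} :
    κ ∈ indices k n s ↔ IsIndex κ ∧ weight κ = k ∧ height κ = s := by
  simp only [indices, Finset.mem_filter, Finset.mem_piAntidiag, weight]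
  constructor
  · rintro ⟨⟨h, -⟩, h1, h2⟩
    exact ⟨h1, h, h2⟩
  · rintro ⟨h1, h, h2⟩
    exact ⟨⟨h, fun i _ => Finset.mem_univ i⟩, h1, h2⟩

open Classical in
/-- The set `I₀(k, n, s)` of admissible indices of weight `k`, depth `n` and height `s`. -/
noncomputable def admissibleIndices (k n s : ℕ) : Finset (Fin n → ℕ) :=
  (indices k n s).filter IsAdmissible

/-- The summation range of the multiple T-series of depth `n`: integer tuples
`0 < m_1 < ⋯ < m_n` with `m_i ≡ i` modulo `2` for `1 ≤ i ≤ n` (here `m_{i+1}` is `m i`). -/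
def SumRange (n : ℕ) : Type :=
  {m : Fin n → ℕ // (∀ i, 0 < m i) ∧ StrictMono m ∧ ∀ i : Fin n, m i ≡ (i : ℕ) + 1 [MOD 2]}

/-- The term `1 / (m_1^{k_1} ⋯ m_n^{k_n})`. -/
noncomputable def term {n : ℕ} (κ : Fin n → ℕ) (m : SumRange n) : ℝ :=
  ∏ i, 1 / (m.1 i : ℝ) ^ κ i

/-- The multiple T-value `T(k_1, …, k_n)`. -/
noncomputable def T {n : ℕ} (κ : Fin n → ℕ) : ℝ := 2 ^ n * ∑' m : SumRange n, term κ m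

/-- `∑_{s=1}^{n} 2^{-s} ∑_{κ ∈ I₀(k,n,s)} T(κ)`. -/
noncomputable def weightedSum (k n : ℕ) : ℝ :=
  ∑ s ∈ Finset.Icc 1 n, 1 / 2 ^ s * ∑ κ ∈ admissibleIndices k n s, T κ

/-- The formal power series `∑_{k > n ≥ 1} weightedSum k n · x^{k-n} y^n` in two variables
`x = X 0`, `y = X 1`: the monomial `x^a y^b` comes from `k = a + b`, `n = b`. -/
noncomputable def weightedSeries : MvPowerSeries (Fin 2) ℝ := fun d =>
  if 1 ≤ d 0 ∧ 1 ≤ d 1 then weightedSum (d 0 + d 1) (d 1) else 0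

/-- The one-variable formal power series `∑_{n ≥ 2} T(n)/(2n) · t^n`. -/
noncomputable def depthOneSeries : PowerSeries ℝ :=
  PowerSeries.mk fun n => if 2 ≤ n then T ![n] / (2 * n) else 0

/-- The formal power series `∑_{n ≥ 2} T(n)/(2n) · (x^n + y^n - (x+y)^n)`. -/
noncomputable def exponentSeries : MvPowerSeries (Fin 2) ℝ :=
  depthOneSeries.subst (MvPowerSeries.X 0 : MvPowerSeries (Fin 2) ℝ)
    + depthOneSeries.subst (MvPowerSeries.X 1 : MvPowerSeries (Fin 2) ℝ)
    - depthOneSeries.subst (MvPowerSeries.X 0 + MvPowerSeries.X 1 : MvPowerSeries (Fin 2) ℝ)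

end MultipleT

/-! Sum over the indices first. For a fixed tuple `m_1 < ⋯ < m_n`, geometric series turn each entry
before the last into `f m = y (1/m + 1/(m - x))` and the last one into `y (1/(m - x) - 1/m)`. The
weight `2 ^ (-height)` is what produces these closed forms: an entry `k = 1` carries `2 y`, an entry
`k ≥ 2` only `y`.

Next fix the last variable `M`. The parity conditions make the sum over the remaining variables a
solution `A` of `A (M + 2) = A M + f (M + 1) * A (M + 1)` (`sum_below`), so the left side becomes `1
- ∑ y (1/(M - x) - 1/M) A M`.

The same recurrence governs moments of Gegenbauer polynomials. Against the weight `s ^ (u - 1) (1 -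
s) ^ (v - 1)` with `u + v = 1 - x` and `v - u = y`, integration by parts and a contiguity relation
show that `m (m - x)` times the `m`-th moment is a constant multiple of `A m`
(`betaFunctional_gegenbauer`). Hence `B(u, v)` times the left side is the sum of all moments. By
Abel's theorem this is the limit as `t → 1` of the integral of the generating function `(1 + 2 (2 s
- 1) t + t ^ 2) ^ (x / 2)`, which degenerates to `(4 s) ^ (x / 2)` and leaves another Beta integral.
The duplication formula then gives a quotient of Gamma values (`one_sub_tsum_alternatingSum`).

On the right, interchanging sums turns the exponential into the product of `(1 - (x + y)/m) / ((1 -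
x/m) (1 - y/m))` over odd `m`, which is the same quotient by the limit formula for Gamma
(`exp_exponent`).

Absolute convergence rests on `‖A M‖ ≤ √M`. The formal identity follows from the analytic one, since
a double power series summing to zero on an open rectangle has zero coefficients
(`mvPowerSeries_eq_zero`). -/

namespace MultipleT

/-! ### Gegenbauer polynomials: recurrences and generating function -/

open Polynomial in
/-- The coefficients of the power series `(1 + 2 v t + t ^ 2) ^ (x / 2)` in `t`, as polynomials
in `v`. Up to the sign of `v` these are the Gegenbauer polynomials of parameter `-x / 2`. -/
noncomputable def gegenbauer (x : ℂ) : ℕ → ℂ[X]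
  | 0 => 1
  | 1 => C x * X
  | m + 2 => C ((m + 2 : ℂ)⁻¹) *
      (C (x - 2 * (m + 1)) * X * gegenbauer x (m + 1) + C (x - m) * gegenbauer x m)

open Polynomial in
theorem gegenbauer_rec (x : ℂ) (m : ℕ) :
    C (m + 2 : ℂ) * gegenbauer x (m + 2) =
      C (x - 2 * (m + 1)) * X * gegenbauer x (m + 1) + C (x - m) * gegenbauer x m := by
  have h : (m + 2 : ℂ) ≠ 0 := by exact_mod_cast (by omega : m + 2 ≠ 0)
  rw [gegenbauer, ← mul_assoc, ← C_mul, mul_inv_cancel₀ h, C_1, one_mul]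

open Polynomial in
theorem gegenbauer_derivative (x : ℂ) (m : ℕ) :
    (1 - X ^ 2) * derivative (gegenbauer x (m + 1)) =
      - (C (m + 1 : ℂ) * X * gegenbauer x (m + 1)) - C (m - x) * gegenbauer x m := by
  have key (m : ℕ) : C (m + 2 : ℂ) * derivative (gegenbauer x (m + 2)) =
      C (x - 2 * (m + 1)) * (gegenbauer x (m + 1) + X * derivative (gegenbauer x (m + 1)))
        + C (x - m) * derivative (gegenbauer x m) := by
    have := congrArg derivative (gegenbauer_rec x m)
    simp only [derivative_mul, derivative_C, derivative_add, derivative_X] at this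
    linear_combination this
  have cancel (m : ℕ) {p q : ℂ[X]} (h : C (m + 2 : ℂ) * p = C (m + 2 : ℂ) * q) : p = q :=
    mul_left_cancel₀ (C_ne_zero.mpr (by exact_mod_cast (by omega : m + 2 ≠ 0))) h
  induction m using Nat.twoStepInduction with
  | zero =>
    simp only [gegenbauer, derivative_mul, derivative_C, derivative_X, zero_add, Nat.cast_zero,
      zero_sub, C_neg, C_1]
    ring
  | one =>
    have h1 := gegenbauer_rec x 0
    have h2 := key 0
    apply cancel 0
    simp only [zero_add, Nat.cast_zero, C_sub, C_add, C_mul, Nat.cast_one, map_ofNat, C_1, C_0]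
      at h1 h2 ⊢
    have h3 : gegenbauer x 0 = 1 := rfl
    have h4 : gegenbauer x 1 = C x * X := rfl
    rw [h3, h4] at h1 h2
    rw [h4]
    simp only [derivative_mul, derivative_C, derivative_X, derivative_one] at h2
    linear_combination (1 - X ^ 2) * h2 + 2 * X * h1
  | more m ih1 ih2 =>
    have h1 := gegenbauer_rec x m
    have h2 := gegenbauer_rec x (m + 1)
    have h3 := key (m + 1)
    apply cancel (m + 1)
    simp only [Nat.cast_add, C_sub, C_add, C_mul, Nat.cast_one, C_1, map_ofNat,
      Nat.cast_ofNat] at *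
    linear_combination (1 - X ^ 2) * h3 + (C x - 2 * ((C (m : ℂ) + 1) + 1)) * X * ih2
      + (C x - (C (m : ℂ) + 1)) * ih1 + (C (m : ℂ) + 3) * X * h2
      - (C x - (C (m : ℂ) + 1)) * h1

-- The bracket on the left is what integration by parts produces against a Beta weight with `u + v =
-- 1 - x`. Taking moments therefore yields a three-term recurrence in which the derivative no longer
-- appears.
open Polynomial in
theorem gegenbauer_contiguous (x : ℂ) (m : ℕ) :
    C (2 * (m + 1) - x) * ((1 - X ^ 2) * derivative (gegenbauer x (m + 1))
        - C (1 - x) * X * gegenbauer x (m + 1)) =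
      C ((m + 2) * (m + 2 - x)) * gegenbauer x (m + 2) - C (m * (m - x)) * gegenbauer x m := by
  have h1 := gegenbauer_rec x m
  rw [gegenbauer_derivative]
  simp only [C_sub, C_add, C_mul, C_1, map_ofNat] at *
  linear_combination -(C (m : ℂ) + 2 - C x) * h1

theorem succ_mul_choose_succ (a : ℂ) (n : ℕ) :
    (n + 1 : ℂ) * Ring.choose a (n + 1) = (a - n) * Ring.choose a n := by
  rw [Ring.choose_eq_smul, Ring.choose_eq_smul, descPochhammer_succ_right, Polynomial.smeval_mul,
    Nat.factorial_succ]
  have h : (n + 1 : ℂ) ≠ 0 := by exact_mod_cast (by omega : n + 1 ≠ 0)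
  have h' : (n.factorial : ℂ) ≠ 0 := by exact_mod_cast n.factorial_ne_zero
  simp only [smul_eq_mul, Polynomial.smeval_sub, Polynomial.smeval_X, Polynomial.smeval_natCast,
    pow_one, pow_zero, nsmul_eq_mul, mul_one]
  push_cast
  field_simp

/-- Consecutive coefficients have ratio `(a - n) / (n + 1)`, of norm at most one. -/
theorem norm_choose_le_one {a : ℂ} (ha : ‖a‖ ≤ 1) (n : ℕ) : ‖Ring.choose a n‖ ≤ 1 := by
  induction n with
  | zero => simp
  | succ n ih =>
    have h := congrArg norm (succ_mul_choose_succ a n)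
    rw [norm_mul, norm_mul] at h
    have h1 : ‖(n + 1 : ℂ)‖ = n + 1 := by
      have := Complex.norm_natCast (n + 1); push_cast at this; exact this
    have h2 : ‖a - n‖ ≤ n + 1 := by
      have := norm_sub_le a n; rw [Complex.norm_natCast] at this; linarith
    rw [h1] at h
    have h3 : ‖a - n‖ * ‖Ring.choose a n‖ ≤ (n + 1) * 1 := by gcongr
    have h4 : (0 : ℝ) < n + 1 := by positivity
    nlinarith

/-- The binomial series `∑ (a choose n) (p t) ^ n`. -/
noncomputable def binomialPowerSeries (a p : ℂ) : PowerSeries ℂ :=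
  PowerSeries.mk fun n => Ring.choose a n * p ^ n

open PowerSeries in
theorem binomialPowerSeries_derivative (a p : ℂ) :
    (1 + C p * X) * derivative ℂ (binomialPowerSeries a p) =
      C (a * p) * binomialPowerSeries a p := by
  ext n
  have h0 := succ_mul_choose_succ a n
  rw [add_mul, one_mul, map_add, mul_assoc, coeff_C_mul, coeff_C_mul, coeff_derivative,
    binomialPowerSeries, coeff_mk, coeff_mk]
  rcases n with _ | n
  · simp at h0 ⊢
  · rw [coeff_succ_X_mul, coeff_derivative, coeff_mk]
    push_cast at h0 ⊢
    linear_combination p ^ (n + 2) * h0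

-- The factorization `1 + 2 v t + t ^ 2 = (1 + p t) (1 + q t)` splits the generating function into
-- two binomial series.
open PowerSeries in
theorem gegenbauer_eval {x a p q v : ℂ} (hx : x = 2 * a) (hpq : p * q = 1) (hv : p + q = 2 * v)
    (m : ℕ) : (gegenbauer x m).eval v =
      coeff m (binomialPowerSeries a p * binomialPowerSeries a q) := by
  set A := binomialPowerSeries a p with hA
  set B := binomialPowerSeries a q with hB
  have h1 := binomialPowerSeries_derivative a p
  have h2 := binomialPowerSeries_derivative a q
  have hpq' : (C p * C q : PowerSeries ℂ) = 1 := by rw [← map_mul, hpq, map_one]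
  have hv' : (C p + C q : PowerSeries ℂ) = C (2 * v) := by rw [← map_add, hv]
  -- For `F = A * B` this is `(1 + 2 v t + t ^ 2) F' = x (v + t) F`; comparing coefficients gives
  -- `gegenbauer_rec`.
  have h3 : derivative ℂ (A * B) + C (2 * v) * (X * derivative ℂ (A * B))
      + X * (X * derivative ℂ (A * B)) = C (x * v) * (A * B) + C x * (X * (A * B)) := by
    rw [← hA] at h1
    rw [← hB] at h2
    have hx' : (C x : PowerSeries ℂ) = 2 * C a := by rw [hx, map_mul, map_ofNat]
    have hv2 : (C v : PowerSeries ℂ) * 2 = C p + C q := by rw [hv', map_mul, mul_comm, map_ofNat]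
    rw [Derivation.leibniz, smul_eq_mul, smul_eq_mul, ← hv', map_mul, hx']
    rw [map_mul] at h1 h2
    linear_combination (exp := 1) (1 + C q * X) * B * h1 + (1 + C p * X) * A * h2
      - (X ^ 2 * (A * derivative ℂ B + B * derivative ℂ A) - 2 * C a * X * A * B) * hpq'
      - C a * A * B * hv2
  have h0 : coeff 0 (A * B) = 1 := by
    rw [coeff_zero_eq_constantCoeff, map_mul]
    simp [hA, hB, binomialPowerSeries]
  induction m using Nat.twoStepInduction with
  | zero => rw [h0]; simp [gegenbauer]
  | one =>
    have := congrArg (coeff 0) h3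
    simp only [map_add, coeff_C_mul, coeff_zero_X_mul, coeff_derivative, h0] at this
    simp [gegenbauer] at this ⊢
    exact this.symm
  | more m ih1 ih2 =>
    have h := congrArg (coeff (m + 1)) h3
    simp only [map_add, coeff_C_mul, coeff_succ_X_mul, coeff_derivative] at h
    have h4 := congrArg (Polynomial.eval v) (gegenbauer_rec x m)
    simp only [Polynomial.eval_mul, Polynomial.eval_add, Polynomial.eval_C, Polynomial.eval_X]
      at h4
    have h5 : (m + 2 : ℂ) ≠ 0 := by exact_mod_cast (by omega : m + 2 ≠ 0)
    apply mul_left_cancel₀ h5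
    rw [h4, ih1, ih2]
    rcases m with _ | m
    · simp only [coeff_zero_X_mul] at h
      push_cast at h ⊢
      linear_combination -h
    · simp only [coeff_succ_X_mul, coeff_derivative] at h
      push_cast at h ⊢
      linear_combination -h

/-- With `v = cos θ` the roots `p`, `q` are `exp (± i θ)`, so the coefficient is a sum of `m + 1`
products, each of norm at most one. -/
theorem norm_gegenbauer_eval_le {x : ℂ} (hx : ‖x‖ ≤ 2) {v : ℝ} (hv : v ∈ Set.Icc (-1) 1) (m : ℕ) :
    ‖(gegenbauer x m).eval (v : ℂ)‖ ≤ m + 1 := by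
  set θ := Real.arccos v
  have hθ : Real.cos θ = v := Real.cos_arccos hv.1 hv.2
  rw [gegenbauer_eval (a := x / 2) (p := Complex.exp (θ * Complex.I))
    (q := Complex.exp (-θ * Complex.I)) (by ring) (by rw [← Complex.exp_add]; simp)
    (by rw [← hθ, Complex.ofReal_cos, Complex.two_cos]), PowerSeries.coeff_mul]
  refine (norm_sum_le _ _).trans ?_
  have ha : ‖x / 2‖ ≤ 1 := by rw [norm_div, Complex.norm_ofNat]; linarith
  have : ∀ ij ∈ Finset.HasAntidiagonal.antidiagonal m, ‖PowerSeries.coeff ij.1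
      (binomialPowerSeries (x / 2) (Complex.exp (θ * Complex.I))) * PowerSeries.coeff ij.2
      (binomialPowerSeries (x / 2) (Complex.exp (-θ * Complex.I)))‖ ≤ 1 := by
    intro ij _
    simp only [binomialPowerSeries, PowerSeries.coeff_mk, norm_mul, norm_pow]
    rw [Complex.norm_exp_ofReal_mul_I, show (-θ : ℂ) = ((-θ : ℝ) : ℂ) by simp,
      Complex.norm_exp_ofReal_mul_I, one_pow, one_pow, mul_one, mul_one]
    exact mul_le_one₀ (norm_choose_le_one ha _) (norm_nonneg _) (norm_choose_le_one ha _)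
  refine (Finset.sum_le_sum this).trans ?_
  simp

theorem cpow_mul_conj_cpow {z : ℂ} (hz : 0 < z.re) (a : ℂ) :
    z ^ a * (starRingEnd ℂ z) ^ a = ((Complex.normSq z : ℝ) : ℂ) ^ a := by
  have h0 : z ≠ 0 := by rintro rfl; simp at hz
  have harg : z.arg ≠ Real.pi := by
    intro h; rw [Complex.arg_eq_pi_iff] at h; linarith [h.1]
  rw [Complex.cpow_def_of_ne_zero h0, Complex.cpow_def_of_ne_zero (by simpa using h0),
    Complex.cpow_def_of_ne_zero (by simpa using h0), ← Complex.exp_add, Complex.log_conj _ harg,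
    ← add_mul, Complex.add_conj, Complex.log_re, ← Complex.ofReal_log (Complex.normSq_nonneg z),
    Complex.normSq_eq_norm_sq, Real.log_pow]
  push_cast
  rfl

theorem hasSum_binomial {a z : ℂ} (hz : ‖z‖ < 1) :
    HasSum (fun n : ℕ => Ring.choose a n * z ^ n) ((1 + z) ^ a) := by
  have h := (Complex.one_add_cpow_hasFPowerSeriesOnBall_zero (a := a)).hasSum (y := z)
    (by rw [← ENNReal.ofReal_one, Metric.eball_ofReal]; simpa using hz)
  simpa [-FormalMultilinearSeries.apply_eq_prod_smul_coeff] using h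

theorem hasSum_gegenbauer {x : ℂ} (hx : ‖x‖ ≤ 2) {v t : ℝ} (hv : v ∈ Set.Icc (-1) 1)
    (ht : t ∈ Set.Ico 0 1) :
    HasSum (fun m => (gegenbauer x m).eval (v : ℂ) * (t : ℂ) ^ m)
      (((1 + 2 * v * t + t ^ 2 : ℝ) : ℂ) ^ (x / 2)) := by
  set θ := Real.arccos v with hθdef
  have hθ : Real.cos θ = v := Real.cos_arccos hv.1 hv.2
  set p := Complex.exp (θ * Complex.I) with hp
  set q := Complex.exp (-θ * Complex.I) with hq
  have hpn : ‖p‖ = 1 := Complex.norm_exp_ofReal_mul_I θ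
  have hqc : q = starRingEnd ℂ p := by
    rw [hp, hq, ← Complex.exp_conj]; simp
  have hqn : ‖q‖ = 1 := by rw [hqc, Complex.norm_conj, hpn]
  have hpt : ‖p * t‖ < 1 := by
    rw [norm_mul, hpn, one_mul, Complex.norm_real, Real.norm_eq_abs, abs_of_nonneg ht.1]
    exact ht.2
  have hqt : ‖q * t‖ < 1 := by
    rw [norm_mul, hqn, one_mul, Complex.norm_real, Real.norm_eq_abs, abs_of_nonneg ht.1]
    exact ht.2
  have ha : ‖x / 2‖ ≤ 1 := by rw [norm_div, Complex.norm_ofNat]; linarith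
  have hsum {z : ℂ} (hz : ‖z‖ < 1) : Summable fun n : ℕ => ‖Ring.choose (x / 2) n * z ^ n‖ := by
    refine Summable.of_nonneg_of_le (fun _ => norm_nonneg _) (fun n => ?_)
      (summable_geometric_of_lt_one (norm_nonneg z) hz)
    rw [norm_mul, norm_pow]
    exact mul_le_of_le_one_left (by positivity) (norm_choose_le_one ha n)
  have hterm (m : ℕ) : (gegenbauer x m).eval (v : ℂ) * (t : ℂ) ^ m =
      ∑ ij ∈ Finset.HasAntidiagonal.antidiagonal m, (Ring.choose (x / 2) ij.1 * (p * t) ^ ij.1) *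
        (Ring.choose (x / 2) ij.2 * (q * t) ^ ij.2) := by
    rw [gegenbauer_eval (a := x / 2) (p := p) (q := q) (by ring)
      (by rw [← Complex.exp_add]; simp)
      (by rw [← hθ, Complex.ofReal_cos, Complex.two_cos]), PowerSeries.coeff_mul,
      Finset.sum_mul]
    refine Finset.sum_congr rfl fun ij hij => ?_
    rw [← Finset.HasAntidiagonal.mem_antidiagonal.mp hij]
    simp only [binomialPowerSeries, PowerSeries.coeff_mk]
    ring
  have hre : 0 < (1 + p * t).re := by
    have := (Complex.abs_re_le_norm (p * t))
    have := neg_le_of_abs_le this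
    simp only [Complex.add_re, Complex.one_re]
    linarith
  have hval : ((1 + 2 * v * t + t ^ 2 : ℝ) : ℂ) ^ (x / 2) =
      (1 + p * t) ^ (x / 2) * (1 + q * t) ^ (x / 2) := by
    have : 1 + q * t = starRingEnd ℂ (1 + p * t) := by rw [hqc]; simp
    rw [this, cpow_mul_conj_cpow hre]
    congr 2
    have e1 : p.re = v := by rw [hp, Complex.exp_ofReal_mul_I_re, hθ]
    have e2 : p.re ^ 2 + p.im ^ 2 = 1 := by
      rw [hp, Complex.exp_ofReal_mul_I_re, Complex.exp_ofReal_mul_I_im]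
      exact Real.cos_sq_add_sin_sq θ
    simp only [Complex.normSq_apply, Complex.add_re, Complex.add_im, Complex.one_re,
      Complex.one_im, Complex.mul_re, Complex.mul_im, Complex.ofReal_re, Complex.ofReal_im]
    rw [← e1]
    linear_combination -t ^ 2 * e2
  simp_rw [hterm]
  rw [hval, ← (hasSum_binomial hpt).tsum_eq, ← (hasSum_binomial hqt).tsum_eq,
    tsum_mul_tsum_eq_tsum_sum_antidiagonal_of_summable_norm (hsum hpt) (hsum hqt)]
  exact (summable_norm_sum_mul_antidiagonal_of_summable_norm (hsum hpt) (hsum hqt)).of_norm.hasSum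

/-! ### Moments against the Beta weight -/

/-- The integrand of the Beta integral. -/
noncomputable def betaWeight (u v : ℂ) (s : ℝ) : ℂ := (s : ℂ) ^ (u - 1) * (1 - (s : ℂ)) ^ (v - 1)

/-- The integral of a polynomial in `2 s - 1` against the weight `s ^ (u - 1) (1 - s) ^ (v - 1)`. -/
noncomputable def betaFunctional (u v : ℂ) (p : Polynomial ℂ) : ℂ :=
  ∫ s in (0 : ℝ)..1, betaWeight u v s * p.eval (2 * (s : ℂ) - 1)

theorem betaWeight_intervalIntegrable {u v : ℂ} (hu : 0 < u.re) (hv : 0 < v.re) :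
    IntervalIntegrable (betaWeight u v) MeasureTheory.volume 0 1 :=
  Complex.betaIntegral_convergent hu hv

theorem betaWeight_mul_intervalIntegrable {u v : ℂ} (hu : 0 < u.re) (hv : 0 < v.re)
    (p : Polynomial ℂ) :
    IntervalIntegrable (fun s : ℝ => betaWeight u v s * p.eval (2 * (s : ℂ) - 1))
      MeasureTheory.volume 0 1 :=
  (betaWeight_intervalIntegrable hu hv).mul_continuousOn
    (p.continuous.comp (by fun_prop : Continuous fun s : ℝ => 2 * (s : ℂ) - 1)).continuousOn

theorem betaFunctional_sub {u v : ℂ} (hu : 0 < u.re) (hv : 0 < v.re) (p q : Polynomial ℂ) :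
    betaFunctional u v (p - q) = betaFunctional u v p - betaFunctional u v q := by
  rw [betaFunctional, betaFunctional, betaFunctional, ← intervalIntegral.integral_sub
    (betaWeight_mul_intervalIntegrable hu hv p) (betaWeight_mul_intervalIntegrable hu hv q)]
  simp only [Polynomial.eval_sub, mul_sub]

theorem betaFunctional_C_mul (u v c : ℂ) (p : Polynomial ℂ) :
    betaFunctional u v (Polynomial.C c * p) = c * betaFunctional u v p := by
  rw [betaFunctional, betaFunctional, ← intervalIntegral.integral_const_mul]
  simp only [Polynomial.eval_mul, Polynomial.eval_C, mul_left_comm]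

open Polynomial in
/-- Integration by parts against the Beta weight. -/
theorem betaFunctional_derivative {u v : ℂ} (hu : 0 < u.re) (hv : 0 < v.re) (p : ℂ[X]) :
    betaFunctional u v ((1 - X ^ 2) * derivative p - C (u + v) * X * p) =
      betaFunctional u v (C (v - u) * p) := by
  rw [← sub_eq_zero, ← betaFunctional_sub hu hv]
  -- An antiderivative of the difference of the two integrands, zero at both endpoints because `u`
  -- and `v` have positive real part. The factor 2 accounts for `1 - z ^ 2 = 4 s (1 - s)` and `dz =
  -- 2 ds` at `z = 2 s - 1`.
  set F : ℝ → ℂ := fun s => (s : ℂ) ^ u * (1 - (s : ℂ)) ^ v * (2 * p.eval (2 * (s : ℂ) - 1))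
    with hF
  have hp : Continuous fun s : ℝ => 2 * p.eval (2 * (s : ℂ) - 1) :=
    continuous_const.mul (p.continuous.comp (by fun_prop))
  have hc : ContinuousOn F (Set.Icc 0 1) := by
    refine ((continuousOn_of_forall_continuousAt fun s hs => ?_).mul
        (continuousOn_of_forall_continuousAt fun s hs => ?_)).mul hp.continuousOn
    · refine (Complex.continuousAt_cpow_const_of_re_pos (Or.inl ?_) hu).comp
        Complex.continuous_ofReal.continuousAt
      rw [Complex.ofReal_re]; exact hs.1
    · refine (Complex.continuousAt_cpow_const_of_re_pos (Or.inl ?_) hv).comp (by fun_prop)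
      rw [Complex.sub_re, Complex.one_re, Complex.ofReal_re, sub_nonneg]
      exact hs.2
  have hder : ∀ s ∈ Set.Ioo (0 : ℝ) 1, HasDerivAt F (betaWeight u v s *
      ((1 - X ^ 2) * derivative p - C (u + v) * X * p - C (v - u) * p).eval (2 * (s : ℂ) - 1))
      s := by
    intro s hs
    have hs0 : (s : ℂ) ≠ 0 := by exact_mod_cast hs.1.ne'
    have hs1 : (1 - (s : ℂ)) ≠ 0 := by exact_mod_cast (sub_pos.mpr hs.2).ne'
    have U : HasDerivAt (fun z : ℂ => z ^ u) (u * (s : ℂ) ^ (u - 1) * 1) (s : ℂ) :=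
      (hasDerivAt_id (s : ℂ)).cpow_const (Or.inl (by simpa using hs.1))
    have V : HasDerivAt (fun z : ℂ => (1 - z) ^ v) (v * (1 - (s : ℂ)) ^ (v - 1) * (-1)) (s : ℂ) :=
      ((hasDerivAt_id (s : ℂ)).const_sub 1).cpow_const (Or.inl (by simpa using hs.2))
    have W : HasDerivAt (fun z : ℂ => 2 * p.eval (2 * z - 1))
        (2 * ((derivative p).eval (2 * (s : ℂ) - 1) * (2 * 1))) (s : ℂ) := by
      have L : HasDerivAt (fun z : ℂ => 2 * z - 1) (2 * 1) (s : ℂ) :=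
        ((hasDerivAt_id (s : ℂ)).const_mul 2).sub_const 1
      exact (HasDerivAt.comp (s : ℂ) (p.hasDerivAt (2 * (s : ℂ) - 1)) L).const_mul 2
    have e1 : (s : ℂ) ^ u = (s : ℂ) ^ (u - 1) * s := by
      rw [Complex.cpow_sub _ _ hs0, Complex.cpow_one, div_mul_cancel₀ _ hs0]
    have e2 : (1 - (s : ℂ)) ^ v = (1 - (s : ℂ)) ^ (v - 1) * (1 - s) := by
      rw [Complex.cpow_sub _ _ hs1, Complex.cpow_one, div_mul_cancel₀ _ hs1]
    convert! ((U.mul V).mul W).comp_ofReal using 1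
    simp only [betaWeight, Pi.mul_apply, e1, e2, eval_sub, eval_mul, eval_C, eval_X, eval_one,
      eval_pow]
    ring
  have h := intervalIntegral.integral_eq_sub_of_hasDerivAt_of_le zero_le_one hc hder
    (betaWeight_mul_intervalIntegrable hu hv _)
  have hu0 : u ≠ 0 := by rintro rfl; simp at hu
  have hv0 : v ≠ 0 := by rintro rfl; simp at hv
  rw [betaFunctional, h]
  simp [hF, hu0, hv0]

/-- The solution of `u (m + 2) = u m + f (m + 1) * u (m + 1)` with `u 0 = 0` and `u 1 = 1`. -/
def alternatingSum {R : Type*} [Semiring R] (f : ℕ → R) : ℕ → R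
  | 0 => 0
  | 1 => 1
  | m + 2 => alternatingSum f m + f (m + 1) * alternatingSum f (m + 1)

/-- Both sides satisfy the recurrence of `alternatingSum`: for the left side it is the integrated
form of `gegenbauer_contiguous`. The constant is fixed by the first moment. -/
theorem betaFunctional_gegenbauer {x y u v : ℂ} (hu : 0 < u.re) (hv : 0 < v.re)
    (hx : u + v = 1 - x) (hy : v - u = y) (hx' : ∀ m : ℕ, (m + 1 : ℂ) ≠ x) (m : ℕ) :
    m * (m - x) * betaFunctional u v (gegenbauer x m) =
      -(x * y * Complex.betaIntegral u v) *
        alternatingSum (fun m : ℕ => y * (1 / (m : ℂ) + 1 / (m - x))) m := by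
  have h0 : betaFunctional u v 1 = Complex.betaIntegral u v := by
    simp [betaFunctional, betaWeight, Complex.betaIntegral]
  induction m using Nat.twoStepInduction with
  | zero => simp [alternatingSum]
  | one =>
    have h := betaFunctional_derivative hu hv 1
    have e : (1 - Polynomial.X ^ 2) * Polynomial.derivative (1 : Polynomial ℂ)
        - Polynomial.C (u + v) * Polynomial.X * 1 =
        Polynomial.C (-(u + v)) * Polynomial.X := by simp; ring
    rw [e, betaFunctional_C_mul, betaFunctional_C_mul, hx, hy, h0] at h
    rw [gegenbauer, betaFunctional_C_mul, alternatingSum]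
    push_cast
    linear_combination (-x) * h
  | more m ih1 ih2 =>
    have h := congrArg (betaFunctional u v) (gegenbauer_contiguous x m)
    rw [betaFunctional_C_mul, ← hx, betaFunctional_derivative hu hv, betaFunctional_sub hu hv,
      betaFunctional_C_mul, betaFunctional_C_mul, betaFunctional_C_mul, hy] at h
    have h1 : (m + 1 : ℂ) ≠ 0 := by exact_mod_cast m.succ_ne_zero
    have h2 : (m + 1 - x : ℂ) ≠ 0 := sub_ne_zero.mpr (hx' m)
    rw [alternatingSum]
    push_cast at ih2 ⊢
    -- This partial fraction converts the factor `2 (m + 1) - x` of the contiguity relation into the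
    -- coefficient of `alternatingSum`.
    have h3 : (1 / (m + 1 : ℂ) + 1 / (m + 1 - x)) * ((m + 1) * (m + 1 - x)) = 2 * (m + 1) - x := by
      field_simp
      ring
    linear_combination -h + ih1 + y * (1 / (m + 1 : ℂ) + 1 / (m + 1 - x)) * ih2
      - y * betaFunctional u v (gegenbauer x (m + 1)) * h3

theorem hasSum_betaFunctional_gegenbauer {x u v : ℂ} (hu : 0 < u.re) (hv : 0 < v.re)
    (hx : ‖x‖ ≤ 2) {t : ℝ} (ht : t ∈ Set.Ico 0 1) :
    HasSum (fun m => betaFunctional u v (gegenbauer x m) * (t : ℂ) ^ m)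
      (∫ s in (0 : ℝ)..1, betaWeight u v s *
        ((1 + 2 * (2 * s - 1) * t + t ^ 2 : ℝ) : ℂ) ^ (x / 2)) := by
  have hint_uv := betaWeight_intervalIntegrable hu hv
  have hsum : Summable fun m : ℕ => (m + 1 : ℝ) * t ^ m := by
    have h1 := summable_pow_mul_geometric_of_norm_lt_one 1 (r := t)
      (by rw [Real.norm_eq_abs, abs_of_nonneg ht.1]; exact ht.2)
    have h2 := summable_geometric_of_lt_one ht.1 ht.2
    exact (h1.add h2).congr fun m => by simp; ring
  have hcast (s : ℝ) : (2 * (s : ℂ) - 1) = ((2 * s - 1 : ℝ) : ℂ) := by push_cast; ring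
  have hmem {s : ℝ} (hs : s ∈ Set.uIoc (0 : ℝ) 1) : 2 * s - 1 ∈ Set.Icc (-1 : ℝ) 1 := by
    rw [Set.uIoc_of_le zero_le_one] at hs
    constructor <;> linarith [hs.1, hs.2]
  have := intervalIntegral.hasSum_integral_of_dominated_convergence
    (μ := MeasureTheory.volume) (a := 0) (b := 1)
    (F := fun m s => betaWeight u v s * (gegenbauer x m).eval (2 * (s : ℂ) - 1) * (t : ℂ) ^ m)
    (f := fun s => betaWeight u v s * ((1 + 2 * (2 * s - 1) * t + t ^ 2 : ℝ) : ℂ) ^ (x / 2))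
    (fun m s => ‖betaWeight u v s‖ * ((m + 1) * t ^ m)) ?_ ?_ ?_ ?_ ?_
  · simpa only [betaFunctional, intervalIntegral.integral_mul_const] using this
  · intro m
    exact ((betaWeight_mul_intervalIntegrable hu hv _).mul_const _).aestronglyMeasurable_restrict_uIoc
  · intro m
    refine .of_forall fun s hs => ?_
    rw [mul_assoc, norm_mul, norm_mul, norm_pow, Complex.norm_real, Real.norm_eq_abs,
      abs_of_nonneg ht.1, hcast]
    have := norm_gegenbauer_eval_le hx (hmem hs) m
    have h0 := ht.1
    gcongr
  · exact .of_forall fun s _ => hsum.mul_left _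
  · simp_rw [tsum_mul_left]
    exact hint_uv.norm.mul_const _
  · refine .of_forall fun s hs => ?_
    simp only [mul_assoc, hcast]
    have := (hasSum_gegenbauer hx (hmem hs) ht).mul_left (betaWeight u v s)
    simpa only [mul_assoc] using this

open Filter Topology in
theorem tendsto_integral_betaWeight {x u v : ℂ} (hu : 0 < u.re) (hv : 0 < v.re)
    (hux : 0 < (u + x / 2).re) :
    Tendsto (fun t : ℝ => ∫ s in (0 : ℝ)..1, betaWeight u v s *
        ((1 + 2 * (2 * s - 1) * t + t ^ 2 : ℝ) : ℂ) ^ (x / 2)) (𝓝[<] 1)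
      (𝓝 (4 ^ (x / 2) * Complex.betaIntegral (u + x / 2) v)) := by
  have hw (c : ℝ) (hc : 0 < c) : ∀ s ∈ Set.uIoc (0 : ℝ) 1,
      betaWeight u v s * ((c * s : ℝ) : ℂ) ^ (x / 2) =
        (c : ℂ) ^ (x / 2) * betaWeight (u + x / 2) v s := by
    intro s hs
    rw [Set.uIoc_of_le zero_le_one] at hs
    have hs0 : (s : ℂ) ≠ 0 := by exact_mod_cast hs.1.ne'
    rw [betaWeight, betaWeight, Complex.ofReal_mul, Complex.mul_cpow_ofReal_nonneg hc.le hs.1.le,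
      show u + x / 2 - 1 = (u - 1) + x / 2 by ring, Complex.cpow_add _ _ hs0]
    ring
  have hint_uv := betaWeight_intervalIntegrable hu hv
  have hint_uv' := betaWeight_intervalIntegrable hux hv
  have hlim : (4 : ℂ) ^ (x / 2) * Complex.betaIntegral (u + x / 2) v =
      ∫ s in (0 : ℝ)..1, betaWeight u v s * ((4 * s : ℝ) : ℂ) ^ (x / 2) := by
    rw [intervalIntegral.integral_congr_ae (.of_forall (hw 4 (by norm_num))),
      intervalIntegral.integral_const_mul]
    simp [Complex.betaIntegral, betaWeight]
  rw [hlim]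
  refine intervalIntegral.tendsto_integral_filter_of_dominated_convergence
    (fun s => ‖betaWeight u v s‖ * 4 ^ (x / 2).re
      + ‖(2 : ℂ) ^ (x / 2) * betaWeight (u + x / 2) v s‖) ?_ ?_ ?_ ?_
  · refine .of_forall fun t => hint_uv.aestronglyMeasurable_restrict_uIoc.mul ?_
    apply Measurable.aestronglyMeasurable
    fun_prop
  · filter_upwards [Ioo_mem_nhdsLT (show (1 / 2 : ℝ) < 1 by norm_num)] with t ht
    refine .of_forall fun s hs => ?_
    rw [show (2 : ℂ) ^ (x / 2) = ((2 : ℝ) : ℂ) ^ (x / 2) by norm_num, ← hw 2 (by norm_num) s hs,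
      norm_mul, norm_mul, ← mul_add]
    rw [Set.uIoc_of_le zero_le_one] at hs
    have h2 : 0 < 2 * s := by linarith [hs.1]
    -- The right side is `(1 - t) ^ 2 + 4 s t`, and `t > 1 / 2`.
    have hlow : 2 * s ≤ 1 + 2 * (2 * s - 1) * t + t ^ 2 := by
      nlinarith [sq_nonneg (1 - t), ht.1, ht.2, hs.1]
    have hup : 1 + 2 * (2 * s - 1) * t + t ^ 2 ≤ 4 := by
      nlinarith [mul_nonneg (sub_nonneg.mpr hs.2) (by linarith [ht.1] : (0 : ℝ) ≤ t), ht.1, ht.2]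
    rw [Complex.norm_cpow_eq_rpow_re_of_pos (h2.trans_le hlow),
      Complex.norm_cpow_eq_rpow_re_of_pos h2]
    gcongr
    -- The base lies in `[2 s, 4]`. The upper end controls the power when the exponent has
    -- nonnegative real part, the lower end otherwise; the dominating function adds the two bounds.
    rcases le_total 0 (x / 2).re with h | h
    · have := Real.rpow_le_rpow (h2.trans_le hlow).le hup h
      have h3 : 0 ≤ (2 * s) ^ (x / 2).re := by positivity
      linarith
    · have := Real.rpow_le_rpow_of_nonpos h2 hlow h
      have h3 : (0 : ℝ) ≤ 4 ^ (x / 2).re := by positivity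
      linarith
  · exact (hint_uv.norm.mul_const _).add (hint_uv'.const_mul _).norm
  · refine .of_forall fun s hs => ?_
    rw [Set.uIoc_of_le zero_le_one] at hs
    have h4 : (1 + 2 * (2 * s - 1) * 1 + 1 ^ 2 : ℝ) = 4 * s := by ring
    have hc : ContinuousAt (fun t : ℝ => betaWeight u v s *
        ((1 + 2 * (2 * s - 1) * t + t ^ 2 : ℝ) : ℂ) ^ (x / 2)) 1 := by
      refine continuousAt_const.mul (ContinuousAt.cpow (by fun_prop) continuousAt_const ?_)
      rw [h4]
      exact Complex.ofReal_mem_slitPlane.mpr (by linarith [hs.1])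
    have := hc.tendsto.mono_left (nhdsWithin_le_nhds (s := Set.Iio 1))
    rwa [h4] at this

/-! ### The alternating sum as a quotient of Gamma values -/

theorem one_sub_tsum_alternatingSum {x y : ℂ} (hx : ‖x‖ < 1 / 2) (hy : ‖y‖ < 1 / 4)
    (hs : Summable fun m : ℕ => y * (1 / ((m + 1 : ℕ) - x) - 1 / ((m + 1 : ℕ) : ℂ)) *
      alternatingSum (fun m : ℕ => y * (1 / (m : ℂ) + 1 / (m - x))) (m + 1)) :
    1 - ∑' m : ℕ, y * (1 / ((m + 1 : ℕ) - x) - 1 / ((m + 1 : ℕ) : ℂ)) *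
      alternatingSum (fun m : ℕ => y * (1 / (m : ℂ) + 1 / (m - x))) (m + 1) =
    Complex.Gamma ((1 - x) / 2) * Complex.Gamma ((1 - y) / 2) /
      (Complex.Gamma (1 / 2) * Complex.Gamma ((1 - x - y) / 2)) := by
  have hxr := (Complex.abs_re_le_norm x).trans_lt hx
  have hyr := (Complex.abs_re_le_norm y).trans_lt hy
  rw [abs_lt] at hxr hyr
  -- The parameters are the solution of `u + v = 1 - x`, `v - u = y`.
  set u : ℂ := (1 - x - y) / 2 with hu_def
  set v : ℂ := (1 - x + y) / 2 with hv_def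
  have half_re (z : ℂ) : (z / 2).re = z.re / 2 := by
    simp
  have hu : 0 < u.re := by
    rw [hu_def, half_re]; simp; linarith
  have hv : 0 < v.re := by
    rw [hv_def, half_re]; simp; linarith
  have hux : 0 < (u + x / 2).re := by
    rw [show u + x / 2 = (1 - y) / 2 by rw [hu_def]; ring, half_re]; simp; linarith
  have hx' (m : ℕ) : (m + 1 : ℂ) ≠ x := by
    rintro h
    have := congrArg Complex.re h
    simp at this
    have h0 : (0 : ℝ) ≤ m := m.cast_nonneg
    linarith
  set f : ℕ → ℂ := fun m => y * (1 / (m : ℂ) + 1 / (m - x)) with hf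
  set K := Complex.betaIntegral u v with hK
  set M : ℕ → ℂ := fun m => betaFunctional u v (gegenbauer x m) with hM
  have hM0 : M 0 = K := by
    simp [hM, gegenbauer, betaFunctional, hK, Complex.betaIntegral, betaWeight]
  have hM1 (m : ℕ) : M (m + 1) = -K * (y * (1 / ((m + 1 : ℕ) - x) - 1 / ((m + 1 : ℕ) : ℂ)) *
      alternatingSum f (m + 1)) := by
    have h := betaFunctional_gegenbauer (y := y) hu hv (by rw [hu_def, hv_def]; ring)
      (by rw [hu_def, hv_def]; ring) hx' (m + 1)
    have h1 : ((m + 1 : ℕ) : ℂ) ≠ 0 := by exact_mod_cast m.succ_ne_zero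
    have h2 : (((m + 1 : ℕ) : ℂ) - x) ≠ 0 := by push_cast; exact sub_ne_zero.mpr (hx' m)
    rw [← mul_right_inj' (mul_ne_zero h1 h2), h]
    field_simp
    ring
  have hMsum : HasSum M (K * (1 - ∑' m : ℕ, y * (1 / ((m + 1 : ℕ) - x) - 1 / ((m + 1 : ℕ) : ℂ)) *
      alternatingSum f (m + 1))) := by
    have h := hs.hasSum.mul_left (-K)
    simp_rw [← hM1] at h
    rw [hasSum_nat_add_iff' (f := M) 1 |>.symm]
    rw [Finset.sum_range_one, hM0, mul_sub, mul_one, sub_sub_cancel_left, ← neg_mul]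
    exact h
  -- The generating function is integrated only for `t < 1`; Abel's theorem carries the result to
  -- the convergent series at `t = 1`.
  have habel := Complex.tendsto_tsum_powerSeries_nhdsWithin_lt hMsum.tendsto_sum_nat
  rw [Filter.tendsto_map'_iff] at habel
  have hlim := tendsto_integral_betaWeight (x := x) hu hv hux
  have huniq := tendsto_nhds_unique_of_eventuallyEq habel hlim (by
    filter_upwards [Ioo_mem_nhdsLT (show (0 : ℝ) < 1 by norm_num)] with t ht
    exact (hasSum_betaFunctional_gegenbauer hu hv (by linarith) ⟨ht.1.le, ht.2⟩).tsum_eq)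
  have g1 := Complex.Gamma_mul_Gamma_eq_betaIntegral hu hv
  have g2 := Complex.Gamma_mul_Gamma_eq_betaIntegral hux hv
  -- Duplication absorbs the factor `4 ^ (x / 2) = 2 ^ x` and introduces `√π = Gamma (1 / 2)`.
  have g3 := Complex.Gamma_mul_Gamma_add_half ((1 - x) / 2)
  rw [show u + v = 1 - x by rw [hu_def, hv_def]; ring] at g1
  rw [show u + x / 2 + v = 1 - x / 2 by rw [hu_def, hv_def]; ring,
    show u + x / 2 = (1 - y) / 2 by rw [hu_def]; ring] at g2
  rw [show (1 - x) / 2 + 1 / 2 = 1 - x / 2 by ring, show 2 * ((1 - x) / 2) = 1 - x by ring,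
    show 1 - (1 - x) = x by ring] at g3
  rw [show u + x / 2 = (1 - y) / 2 by rw [hu_def]; ring] at huniq
  have p4 : (4 : ℂ) ^ (x / 2) = 2 ^ x := by
    rw [show (4 : ℂ) = ((2 : ℝ) : ℂ) * ((2 : ℝ) : ℂ) by norm_num,
      Complex.mul_cpow_ofReal_nonneg (by norm_num) (by norm_num),
      ← Complex.cpow_add _ _ (by norm_num)]
    norm_num
  have n1 : Complex.Gamma u ≠ 0 := Complex.Gamma_ne_zero_of_re_pos hu
  have n2 : Complex.Gamma v ≠ 0 := Complex.Gamma_ne_zero_of_re_pos hv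
  have n3 : Complex.Gamma (1 - x) ≠ 0 := Complex.Gamma_ne_zero_of_re_pos (by simp; linarith)
  have n4 : Complex.Gamma (1 - x / 2) ≠ 0 :=
    Complex.Gamma_ne_zero_of_re_pos (by rw [Complex.sub_re, half_re]; simp; linarith)
  have n5 : Complex.Gamma (1 / 2) ≠ 0 := Complex.Gamma_ne_zero_of_re_pos (by norm_num)
  have hhalf : ((√Real.pi : ℝ) : ℂ) = Complex.Gamma (1 / 2) := by
    rw [Complex.Gamma_one_half_eq, Real.sqrt_eq_rpow, Complex.ofReal_cpow Real.pi_pos.le]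
    norm_num
  rw [hhalf] at g3
  rw [p4] at huniq
  have hK0 : K ≠ 0 := by
    intro h
    rw [← hK, h, mul_zero] at g1
    exact mul_ne_zero n1 n2 g1
  rw [eq_div_iff (mul_ne_zero n5 n1), ← mul_right_inj' hK0,
    ← mul_right_inj' (mul_ne_zero n3 (mul_ne_zero n4 n2))]
  linear_combination
    Complex.Gamma (1 - x) * Complex.Gamma (1 - x / 2) * Complex.Gamma v
      * Complex.Gamma (1 / 2) * Complex.Gamma u * huniq
    - Complex.Gamma (1 - x) * Complex.Gamma v * Complex.Gamma (1 / 2) * Complex.Gamma u * 2 ^ x * g2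
    + Complex.Gamma (1 - x / 2) * Complex.Gamma ((1 - x) / 2) * Complex.Gamma ((1 - y) / 2)
      * Complex.Gamma v * g1
    - Complex.Gamma ((1 - y) / 2) * Complex.Gamma v ^ 2 * Complex.Gamma u * g3

/-! ### The exponential as a product over odd integers -/

/-- The summation range in depth one consists of the odd positive integers. -/
def sumRangeOneEquiv : ℕ ≃ SumRange 1 where
  toFun j := ⟨fun _ => 2 * j + 1, fun _ => Nat.succ_pos _, Subsingleton.strictMono _, fun i => by
    fin_cases i; simp [Nat.ModEq, Nat.add_mod]⟩
  invFun m := m.1 0 / 2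
  left_inv j := by simp; omega
  right_inv m := by
    have h := m.2.2.2 0
    simp only [Nat.ModEq, Fin.val_zero] at h
    refine Subtype.ext (funext fun i => ?_)
    rw [Subsingleton.elim i 0]
    show 2 * (m.1 0 / 2) + 1 = m.1 0
    omega

theorem T_depth_one (n : ℕ) : T ![n] = 2 * ∑' j : ℕ, 1 / (2 * j + 1 : ℝ) ^ n := by
  rw [T, pow_one, ← sumRangeOneEquiv.tsum_eq]
  congr 1
  refine tsum_congr fun j => ?_
  rw [term, Fin.prod_univ_one]
  show 1 / ((2 * j + 1 : ℕ) : ℝ) ^ n = _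
  push_cast
  rfl

theorem summable_one_div_odd_pow {n : ℕ} (hn : 2 ≤ n) :
    Summable fun j : ℕ => 1 / (2 * j + 1 : ℝ) ^ n := by
  have h := (Real.summable_one_div_nat_pow.mpr (by omega : 1 < n)).comp_injective
    (i := fun j : ℕ => 2 * j + 1) (fun a b h => by simpa using h)
  exact h.congr fun j => by simp

open Filter Topology in
theorem tendsto_prod_gamma_quotient {x y : ℂ} (hx : ‖x‖ < 1 / 2) (hy : ‖y‖ < 1 / 4) :
    Tendsto (fun N : ℕ => ∏ j ∈ Finset.range (N + 1),
      (1 - (x + y) / (2 * j + 1)) / ((1 - x / (2 * j + 1)) * (1 - y / (2 * j + 1)))) atTop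
      (𝓝 (Complex.Gamma ((1 - x) / 2) * Complex.Gamma ((1 - y) / 2) /
        (Complex.Gamma (1 / 2) * Complex.Gamma ((1 - x - y) / 2)))) := by
  have hxr := (Complex.abs_re_le_norm x).trans_lt hx
  have hyr := (Complex.abs_re_le_norm y).trans_lt hy
  rw [abs_lt] at hxr hyr
  have half_re (z : ℂ) : (z / 2).re = z.re / 2 := by simp
  have n1 : Complex.Gamma ((1 - x - y) / 2) ≠ 0 :=
    Complex.Gamma_ne_zero_of_re_pos (by rw [half_re]; simp; linarith)
  have n2 : Complex.Gamma (1 / 2) ≠ 0 := Complex.Gamma_ne_zero_of_re_pos (by norm_num)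
  have h := ((Complex.GammaSeq_tendsto_Gamma ((1 - x) / 2)).mul
    (Complex.GammaSeq_tendsto_Gamma ((1 - y) / 2))).div
    ((Complex.GammaSeq_tendsto_Gamma (1 / 2)).mul
      (Complex.GammaSeq_tendsto_Gamma ((1 - x - y) / 2))) (mul_ne_zero n2 n1)
  refine h.congr' ?_
  filter_upwards [eventually_gt_atTop 0] with N hN
  have hN0 : (N : ℂ) ≠ 0 := by exact_mod_cast hN.ne'
  have key {z : ℂ} (hz : z.re < 1) (j : ℕ) : 1 - z / (2 * j + 1) ≠ 0 ∧
      (1 - z) / 2 + j = (2 * j + 1) / 2 * (1 - z / (2 * j + 1)) := by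
    have h1 : (2 * j + 1 : ℂ) ≠ 0 := by exact_mod_cast (by omega : 2 * j + 1 ≠ 0)
    refine ⟨fun h0 => ?_, by field_simp; ring⟩
    have h2 : z = 2 * j + 1 := by
      field_simp at h0
      linear_combination -h0
    rw [h2] at hz
    simp at hz
    have h0 : (0 : ℝ) ≤ j := j.cast_nonneg
    linarith
  -- The Gamma arguments above and below have equal sum, so the powers of `N` in the four `GammaSeq`
  -- factors cancel, as do the factorials.
  have hpow : (N : ℂ) ^ ((1 - x) / 2) * (N : ℂ) ^ ((1 - y) / 2) =
      (N : ℂ) ^ (1 / 2 : ℂ) * (N : ℂ) ^ ((1 - x - y) / 2) := by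
    rw [← Complex.cpow_add _ _ hN0, ← Complex.cpow_add _ _ hN0]
    congr 1
    ring
  have hne (z : ℂ) : (N : ℂ) ^ z ≠ 0 := by simp [Complex.cpow_eq_zero_iff, hN0]
  have hfac : (N.factorial : ℂ) ≠ 0 := by exact_mod_cast N.factorial_ne_zero
  have hprod {z : ℂ} (hz : z.re < 1) :
      ∏ j ∈ Finset.range (N + 1), ((1 - z) / 2 + j) =
        (∏ j ∈ Finset.range (N + 1), ((2 * j + 1) / 2 : ℂ)) *
          ∏ j ∈ Finset.range (N + 1), (1 - z / (2 * j + 1)) := by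
    rw [← Finset.prod_mul_distrib]
    exact Finset.prod_congr rfl fun j _ => (key hz j).2
  have hprod0 {z : ℂ} (hz : z.re < 1) :
      ∏ j ∈ Finset.range (N + 1), (1 - z / (2 * j + 1)) ≠ 0 :=
    Finset.prod_ne_zero_iff.mpr fun j _ => (key hz j).1
  have hodd : (∏ j ∈ Finset.range (N + 1), ((2 * j + 1) / 2 : ℂ)) ≠ 0 :=
    Finset.prod_ne_zero_iff.mpr fun j _ => by
      have : (2 * j + 1 : ℂ) ≠ 0 := by exact_mod_cast (by omega : 2 * j + 1 ≠ 0)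
      simpa using this
  have hx1 : x.re < 1 := by linarith
  have hy1 : y.re < 1 := by linarith
  have hxy1 : (x + y).re < 1 := by simp; linarith
  have h01 : (0 : ℂ).re < 1 := by simp
  have hR : ∏ j ∈ Finset.range (N + 1),
      (1 - (x + y) / (2 * j + 1)) / ((1 - x / (2 * j + 1)) * (1 - y / (2 * j + 1))) =
      (∏ j ∈ Finset.range (N + 1), (1 - (x + y) / (2 * j + 1))) /
        ((∏ j ∈ Finset.range (N + 1), (1 - x / (2 * j + 1))) *
          ∏ j ∈ Finset.range (N + 1), (1 - y / (2 * j + 1))) := by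
    rw [Finset.prod_div_distrib, Finset.prod_mul_distrib]
  have e0 := hprod h01
  simp only [sub_zero, zero_div, Finset.prod_const_one, mul_one] at e0
  rw [Pi.div_apply, Complex.GammaSeq, Complex.GammaSeq, Complex.GammaSeq, Complex.GammaSeq,
    show (1 - x - y) / 2 = (1 - (x + y)) / 2 by ring, hprod hx1, hprod hy1, hprod hxy1, e0, hR]
  rw [show (1 - x - y) / 2 = (1 - (x + y)) / 2 by ring] at hpow
  have a1 := hne (1 / 2)
  have a2 := hne ((1 - (x + y)) / 2)
  have b1 := hprod0 hx1
  have b2 := hprod0 hy1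
  have b3 := hprod0 hxy1
  rw [div_mul_div_comm, div_mul_div_comm, div_div_div_eq, div_eq_div_iff (by positivity)
    (by positivity)]
  linear_combination (N.factorial : ℂ) ^ 2 * (∏ j ∈ Finset.range (N + 1), ((2 * j + 1) / 2 : ℂ)) ^ 2
    * (∏ j ∈ Finset.range (N + 1), (1 - x / (2 * j + 1)))
    * (∏ j ∈ Finset.range (N + 1), (1 - y / (2 * j + 1)))
    * (∏ j ∈ Finset.range (N + 1), (1 - (x + y) / (2 * j + 1))) * hpow

/-- The summand `(1 / n) ((x / m) ^ n + (y / m) ^ n - ((x + y) / m) ^ n)` for `m = 2 j + 1`. -/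
noncomputable def logSummand (x y : ℂ) (n j : ℕ) : ℂ :=
  ((x / (2 * j + 1)) ^ n / n + (y / (2 * j + 1)) ^ n / n - ((x + y) / (2 * j + 1)) ^ n / n)

theorem logSummand_eq (x y : ℂ) (n j : ℕ) : logSummand x y n j =
    (x ^ n + y ^ n - (x + y) ^ n) / n * ((1 / (2 * j + 1 : ℝ) ^ n : ℝ) : ℂ) := by
  rw [logSummand, div_pow, div_pow, div_pow]
  push_cast
  ring

theorem norm_odd (j : ℕ) : ‖(2 * j + 1 : ℂ)‖ = 2 * j + 1 := by
  have := Complex.norm_natCast (2 * j + 1)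
  push_cast at this
  exact this

theorem hasSum_logSummand {x y : ℂ} (hx : ‖x‖ < 1 / 2) (hy : ‖y‖ < 1 / 4) (j : ℕ) :
    HasSum (fun n : {n : ℕ // 2 ≤ n} => logSummand x y n j)
      (-Complex.log (1 - x / (2 * j + 1)) + -Complex.log (1 - y / (2 * j + 1))
        - -Complex.log (1 - (x + y) / (2 * j + 1))) := by
  have hxy : ‖x + y‖ < 1 := (norm_add_le x y).trans_lt (by linarith)
  have small {z : ℂ} (hz : ‖z‖ < 1) : ‖z / (2 * j + 1)‖ < 1 := by
    rw [norm_div, norm_odd]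
    exact (div_le_self (norm_nonneg z) (by simp)).trans_lt hz
  have h := ((Complex.hasSum_taylorSeries_neg_log (small (hx.trans (by norm_num)))).add
    (Complex.hasSum_taylorSeries_neg_log (small (hy.trans (by norm_num))))).sub
    (Complex.hasSum_taylorSeries_neg_log (small hxy))
  -- The logarithm series run over all `n`. The term `n = 0` vanishes since division by zero gives
  -- zero, and for `n = 1` the three linear terms cancel.
  refine (hasSum_subtype_iff_of_support_subset (s := {n | 2 ≤ n})
    (f := fun n => logSummand x y n j) fun n hn => ?_).mpr h
  by_contra hlt
  have : n = 0 ∨ n = 1 := by simp at hlt; omega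
  apply hn
  rcases this with rfl | rfl
  · simp [logSummand]
  · simp only [logSummand]
    push_cast
    ring

theorem norm_power_difference_le {x y : ℂ} (hx : ‖x‖ < 1 / 2) (hy : ‖y‖ < 1 / 4) {n : ℕ}
    (hn : 2 ≤ n) : ‖(x ^ n + y ^ n - (x + y) ^ n) / n‖ ≤ 3 * (3 / 4) ^ n := by
  -- The ratio `3 / 4` is `1 / 2 + 1 / 4`.
  have hxy : ‖x + y‖ ≤ 3 / 4 := (norm_add_le x y).trans (by linarith)
  have b {z : ℂ} (hz : ‖z‖ ≤ 3 / 4) : ‖z ^ n‖ ≤ (3 / 4) ^ n := by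
    rw [norm_pow]; gcongr
  have h1 : ‖x ^ n + y ^ n - (x + y) ^ n‖ ≤ 3 * (3 / 4) ^ n := by
    refine (norm_sub_le _ _).trans ?_
    have := norm_add_le (x ^ n) (y ^ n)
    have := b (z := x) (by linarith)
    have := b (z := y) (by linarith)
    have := b hxy
    linarith
  rw [norm_div, Complex.norm_natCast]
  exact (div_le_self (norm_nonneg _) (by exact_mod_cast (by omega : 1 ≤ n))).trans h1

theorem summable_logSummand {x y : ℂ} (hx : ‖x‖ < 1 / 2) (hy : ‖y‖ < 1 / 4) :
    Summable fun p : {n : ℕ // 2 ≤ n} × ℕ => logSummand x y p.1 p.2 := by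
  have hgeo : Summable fun n : {n : ℕ // 2 ≤ n} => 3 * (3 / 4 : ℝ) ^ n.1 :=
    ((summable_geometric_of_lt_one (by norm_num : (0 : ℝ) ≤ 3 / 4) (by norm_num)).mul_left
      3).subtype _
  refine Summable.of_norm_bounded (hgeo.mul_of_nonneg (summable_one_div_odd_pow le_rfl)
    (fun n => by positivity) (fun j => by positivity)) fun p => ?_
  rw [logSummand_eq, norm_mul]
  refine mul_le_mul (norm_power_difference_le hx hy p.1.2) ?_ (norm_nonneg _) (by positivity)
  rw [Complex.norm_real, Real.norm_of_nonneg (by positivity)]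
  exact one_div_le_one_div_of_le (by positivity) (pow_le_pow_right₀ (by simp) p.1.2)

theorem exponent_term_eq (x y : ℂ) (n : {n : ℕ // 2 ≤ n}) :
    HasSum (fun j => logSummand x y n j)
      ((T ![n.1] : ℂ) / (2 * (n.1 : ℂ)) * (x ^ n.1 + y ^ n.1 - (x + y) ^ n.1)) := by
  have h := (Complex.hasSum_ofReal.mpr (summable_one_div_odd_pow n.2).hasSum).mul_left
    ((x ^ n.1 + y ^ n.1 - (x + y) ^ n.1) / n.1)
  simp_rw [logSummand_eq]
  have e : (T ![n.1] : ℂ) / (2 * (n.1 : ℂ)) * (x ^ n.1 + y ^ n.1 - (x + y) ^ n.1) =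
      (x ^ n.1 + y ^ n.1 - (x + y) ^ n.1) / n.1 *
        ((∑' j : ℕ, 1 / (2 * j + 1 : ℝ) ^ n.1 : ℝ) : ℂ) := by
    rw [T_depth_one, Complex.ofReal_mul, Complex.ofReal_ofNat]
    ring
  rw [e]
  exact h

theorem summable_exponent {x y : ℂ} (hx : ‖x‖ < 1 / 2) (hy : ‖y‖ < 1 / 4) :
    Summable fun n : {n : ℕ // 2 ≤ n} =>
      (T ![n.1] : ℂ) / (2 * (n.1 : ℂ)) * (x ^ n.1 + y ^ n.1 - (x + y) ^ n.1) := by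
  have h := (summable_logSummand hx hy).prod
  exact h.congr fun n => ((exponent_term_eq x y n).tsum_eq)

open Filter Topology in
theorem exp_exponent {x y : ℂ} (hx : ‖x‖ < 1 / 2) (hy : ‖y‖ < 1 / 4) :
    Complex.exp (∑' n : {n : ℕ // 2 ≤ n},
      (T ![n.1] : ℂ) / (2 * (n.1 : ℂ)) * (x ^ n.1 + y ^ n.1 - (x + y) ^ n.1)) =
    Complex.Gamma ((1 - x) / 2) * Complex.Gamma ((1 - y) / 2) /
      (Complex.Gamma (1 / 2) * Complex.Gamma ((1 - x - y) / 2)) := by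
  set S := ∑' n : {n : ℕ // 2 ≤ n},
      (T ![n.1] : ℂ) / (2 * (n.1 : ℂ)) * (x ^ n.1 + y ^ n.1 - (x + y) ^ n.1) with hS
  have hs := summable_logSummand hx hy
  have h1 : HasSum (fun p : {n : ℕ // 2 ≤ n} × ℕ => logSummand x y p.1 p.2) S := by
    rw [hS, ← tsum_congr fun n => (exponent_term_eq x y n).tsum_eq, ← hs.tsum_prod]
    exact hs.hasSum
  have h2 : HasSum (fun p : ℕ × {n : ℕ // 2 ≤ n} => logSummand x y p.2 p.1) S :=
    (Equiv.prodComm ℕ {n : ℕ // 2 ≤ n}).hasSum_iff.mpr h1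
  have h3 := (h2.prod_fiberwise fun j => hasSum_logSummand hx hy j).tendsto_sum_nat
  -- The shift by one matches the `N + 1` factors of `GammaSeq` at `N`.
  have h4 := ((Complex.continuous_exp.tendsto S).comp h3).comp (tendsto_add_atTop_nat 1)
  refine tendsto_nhds_unique_of_eventuallyEq h4 (tendsto_prod_gamma_quotient hx hy)
    (.of_forall fun N => ?_)
  have hne {z : ℂ} (hz : ‖z‖ < 1) (j : ℕ) : 1 - z / (2 * j + 1) ≠ 0 := by
    rw [sub_ne_zero]
    intro h
    have h1 : ‖z / (2 * j + 1)‖ < 1 := by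
      rw [norm_div, norm_odd]
      exact (div_le_self (norm_nonneg z) (by simp)).trans_lt hz
    rw [← h] at h1
    simp at h1
  have hxy : ‖x + y‖ < 1 := (norm_add_le x y).trans_lt (by linarith)
  rw [Function.comp_apply, Function.comp_apply, Complex.exp_sum]
  refine Finset.prod_congr rfl fun j _ => ?_
  rw [Complex.exp_sub, Complex.exp_add, Complex.exp_neg, Complex.exp_neg, Complex.exp_neg,
    Complex.exp_log (hne (by linarith) j), Complex.exp_log (hne (by linarith) j),
    Complex.exp_log (hne hxy j), div_inv_eq_mul, ← mul_inv, mul_comm, ← div_eq_mul_inv]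

/-! ### Summation tuples below a given last entry -/

/-- Append an entry to an admissible summation tuple. -/
def SumRange.snoc {n : ℕ} (m : SumRange n) (M : ℕ) (h : ∀ i, m.1 i < M)
    (hM : M ≡ n + 1 [MOD 2]) : SumRange (n + 1) :=
  ⟨Fin.snoc (α := fun _ => ℕ) m.1 M, by
    refine ⟨fun i => ?_, fun i j hij => ?_, fun i => ?_⟩
    · induction i using Fin.lastCases with
      | last =>
        rw [Fin.snoc_last]
        rcases Nat.eq_zero_or_pos n with rfl | hn
        · simp only [Nat.ModEq] at hM; omega
        · exact (Nat.zero_le _).trans_lt (h ⟨0, hn⟩)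
      | cast i => rw [Fin.snoc_castSucc]; exact m.2.1 i
    · induction j using Fin.lastCases with
      | last =>
        induction i using Fin.lastCases with
        | last => exact absurd hij (lt_irrefl _)
        | cast i => rw [Fin.snoc_castSucc, Fin.snoc_last]; exact h i
      | cast j =>
        induction i using Fin.lastCases with
        | last => exact absurd hij (Fin.castSucc_lt_last j).asymm
        | cast i =>
          rw [Fin.snoc_castSucc, Fin.snoc_castSucc]
          exact m.2.2.1 (Fin.castSucc_lt_castSucc_iff.mp hij)
    · induction i using Fin.lastCases with
      | last => rw [Fin.snoc_last]; exact hM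
      | cast i => rw [Fin.snoc_castSucc]; exact m.2.2.2 i⟩

/-- Remove the last entry of a summation tuple. -/
def SumRange.dropLast {n : ℕ} (m : SumRange (n + 1)) : SumRange n :=
  ⟨fun i => m.1 i.castSucc, fun _ => m.2.1 _,
    fun _ _ hij => m.2.2.1 (Fin.castSucc_lt_castSucc_iff.mpr hij), fun i => m.2.2.2 i.castSucc⟩

theorem SumRange.dropLast_lt {n : ℕ} (m : SumRange (n + 1)) (i : Fin n) :
    m.dropLast.1 i < m.1 (Fin.last n) := m.2.2.1 (Fin.castSucc_lt_last i)

theorem SumRange.snoc_dropLast {n : ℕ} (m : SumRange (n + 1)) :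
    m.dropLast.snoc (m.1 (Fin.last n)) m.dropLast_lt (m.2.2.2 (Fin.last n)) = m :=
  Subtype.ext (Fin.snoc_init_self m.1)

theorem SumRange.snoc_inj {n : ℕ} {m m' : SumRange n} {M M' : ℕ} {h h' hM hM'}
    (e : m.snoc M h hM = m'.snoc M' h' hM') : m = m' ∧ M = M' := by
  have e' : (Fin.snoc (α := fun _ => ℕ) m.1 M : Fin (n + 1) → ℕ) =
      Fin.snoc (α := fun _ => ℕ) m'.1 M' := congrArg Subtype.val e
  have := Fin.snoc_injective2 e'
  exact ⟨Subtype.ext this.1, this.2⟩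

theorem SumRange.snoc_castSucc {n : ℕ} (m : SumRange n) (M : ℕ) (h hM) (i : Fin n) :
    (m.snoc M h hM).1 i.castSucc = m.1 i := Fin.snoc_castSucc (α := fun _ => ℕ) M m.1 i

theorem SumRange.snoc_last {n : ℕ} (m : SumRange n) (M : ℕ) (h hM) :
    (m.snoc M h hM).1 (Fin.last n) = M := Fin.snoc_last (α := fun _ => ℕ) M m.1

/-- The summation tuples of any length that can be continued by the entry `M`. -/
def Below (M : ℕ) : Type :=
  {q : Σ n, SumRange n // (∀ i, q.2.1 i < M) ∧ M ≡ q.1 + 1 [MOD 2]}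

/-- A tuple that can be continued by `M + 2` either can be continued by `M`, or ends in `M + 1`. -/
def belowSum (M : ℕ) : Below M ⊕ Below (M + 1) → Below (M + 2) :=
  Sum.elim
    (fun q => ⟨q.1, fun i => (q.2.1 i).trans (by omega), by
      have := q.2.2; simp only [Nat.ModEq] at this ⊢; omega⟩)
    (fun q => ⟨⟨q.1.1 + 1, q.1.2.snoc (M + 1) q.2.1 q.2.2⟩, fun i => by
        induction i using Fin.lastCases with
        | last => exact (SumRange.snoc_last _ _ q.2.1 q.2.2).trans_lt (by omega)
        | cast i => exact (SumRange.snoc_castSucc _ _ q.2.1 q.2.2 i).trans_lt ((q.2.1 i).trans (by omega)),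
      q.2.2.add_right 1⟩)

theorem belowSum_bijective (M : ℕ) : Function.Bijective (belowSum M) := by
  constructor
  · have disj (q : Below M) (q' : Below (M + 1)) :
        belowSum M (Sum.inl q) ≠ belowSum M (Sum.inr q') := by
      obtain ⟨⟨n, m⟩, h, h'⟩ := q
      obtain ⟨⟨n', m'⟩, k, k'⟩ := q'
      intro e
      obtain ⟨en, e2⟩ := Sigma.mk.inj_iff.mp (congrArg Subtype.val e)
      obtain rfl : n = n' + 1 := en
      obtain rfl : m = m'.snoc (M + 1) k k' := eq_of_heq e2
      have h1 : (m'.snoc (M + 1) k k').1 (Fin.last n') < M := h (Fin.last n')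
      rw [SumRange.snoc_last] at h1
      omega
    rintro (q | q) (q' | q') e
    · have e1 : (belowSum M (Sum.inl q)).1 = (belowSum M (Sum.inl q')).1 :=
        congrArg Subtype.val e
      exact congrArg Sum.inl (Subtype.ext e1)
    · exact absurd e (disj q q')
    · exact absurd e.symm (disj q' q)
    · obtain ⟨⟨n, m⟩, h, h'⟩ := q
      obtain ⟨⟨n', m'⟩, k, k'⟩ := q'
      obtain ⟨en, e2⟩ := Sigma.mk.inj_iff.mp (congrArg Subtype.val e)
      obtain rfl : n = n' := Nat.succ_injective en
      obtain ⟨rfl, -⟩ := SumRange.snoc_inj (h := h) (h' := k) (hM := h') (hM' := k') (eq_of_heq e2)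
      rfl
  · rintro ⟨⟨n, m⟩, h, hM⟩
    by_cases hm : ∀ i, m.1 i < M
    · exact ⟨Sum.inl ⟨⟨n, m⟩, hm, by simp only [Nat.ModEq] at hM ⊢; omega⟩, rfl⟩
    · rcases n with _ | n
      · exact absurd (fun i => i.elim0) hm
      -- The last entry is `M` or `M + 1`, and parity excludes `M`.
      have hlast : m.1 (Fin.last n) = M + 1 := by
        push Not at hm
        obtain ⟨i, hi⟩ := hm
        have h1 := hi.trans (m.2.2.1.monotone (Fin.le_last i))
        have h2 := h (Fin.last n)
        have h3 := m.2.2.2 (Fin.last n)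
        simp only [Nat.ModEq, Fin.val_last] at h2 h3 hM
        omega
      refine ⟨Sum.inr ⟨⟨n, m.dropLast⟩, fun i => hlast ▸ m.dropLast_lt i, ?_⟩, ?_⟩
      · simp only [Nat.ModEq] at hM ⊢; omega
      · refine Subtype.ext (Sigma.ext rfl (heq_of_eq ?_))
        have := m.snoc_dropLast
        simp only [hlast] at this
        exact this

theorem below_zero_isEmpty : IsEmpty (Below 0) := by
  refine ⟨fun q => ?_⟩
  obtain ⟨⟨n, m⟩, h, hM⟩ := q
  rcases n with _ | n
  · simp [Nat.ModEq] at hM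
  · exact absurd (h 0) (Nat.not_lt_zero _)

instance : Unique (SumRange 0) where
  default := ⟨Fin.elim0, fun i => i.elim0, fun i => i.elim0, fun i => i.elim0⟩
  uniq _ := Subtype.ext (Subsingleton.elim _ _)

instance : Unique (Below 1) where
  default := ⟨⟨0, default⟩, fun i => i.elim0, rfl⟩
  uniq q := by
    obtain ⟨⟨n, m⟩, h, hM⟩ := q
    rcases n with _ | n
    · exact Subtype.ext (Sigma.ext rfl (heq_of_eq (Unique.uniq _ m)))
    · have h1 := m.2.1 0
      have h2 : m.1 0 < 1 := h 0
      omega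

instance below_finite (M : ℕ) : Finite (Below M) := by
  induction M using Nat.twoStepInduction with
  | zero => have := below_zero_isEmpty; infer_instance
  | one => infer_instance
  | more M ih1 ih2 => exact Finite.of_surjective _ (belowSum_bijective M).2

noncomputable instance (M : ℕ) : Fintype (Below M) := Fintype.ofFinite _

theorem sum_below {R : Type*} [CommSemiring R] (f : ℕ → R) (M : ℕ) :
    ∑ q : Below M, ∏ i, f (q.1.2.1 i) = alternatingSum f M := by
  induction M using Nat.twoStepInduction with
  | zero =>
    have := below_zero_isEmpty
    rw [Finset.univ_eq_empty, Finset.sum_empty, alternatingSum]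
  | one =>
    rw [Fintype.sum_unique, alternatingSum]
    exact Fin.prod_univ_zero _
  | more M ih1 ih2 =>
    rw [← Function.Bijective.sum_comp (belowSum_bijective M), Fintype.sum_sum_type,
      alternatingSum, ← ih1, ← ih2, Finset.mul_sum]
    congr 1
    refine Finset.sum_congr rfl fun q _ => ?_
    obtain ⟨⟨n, m⟩, h, hM⟩ := q
    change ∏ i : Fin (n + 1), f ((m.snoc (M + 1) h hM).1 i) = f (M + 1) * ∏ i, f (m.1 i)
    rw [Fin.prod_univ_castSucc, mul_comm]
    simp only [SumRange.snoc_last, SumRange.snoc_castSucc]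

/-- A nonempty summation tuple is determined by its last entry and the remaining entries. -/
noncomputable def sumRangeSuccEquiv : (Σ M, Below M) ≃ Σ n, SumRange (n + 1) :=
  Equiv.ofBijective (fun q => ⟨q.2.1.1, q.2.1.2.snoc q.1 q.2.2.1 q.2.2.2⟩) (by
    constructor
    · rintro ⟨M, ⟨n, m⟩, h, hM⟩ ⟨M', ⟨n', m'⟩, h', hM'⟩ e
      obtain ⟨en, e2⟩ := Sigma.mk.inj_iff.mp e
      obtain rfl : n = n' := en
      obtain ⟨e3, rfl⟩ := SumRange.snoc_inj (h := h) (h' := h') (hM := hM) (hM' := hM') (eq_of_heq e2)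
      obtain rfl : m = m' := e3
      rfl
    · rintro ⟨n, m⟩
      exact ⟨⟨m.1 (Fin.last n), ⟨n, m.dropLast⟩, m.dropLast_lt, m.2.2.2 (Fin.last n)⟩,
        Sigma.ext rfl (heq_of_eq m.snoc_dropLast)⟩)

theorem prod_sumRangeSuccEquiv {R : Type*} [CommSemiring R] (f g : ℕ → R) (q : Σ M, Below M) :
    (∏ i : Fin (sumRangeSuccEquiv q).1, f ((sumRangeSuccEquiv q).2.1 i.castSucc)) *
      g ((sumRangeSuccEquiv q).2.1 (Fin.last _)) = (∏ i, f (q.2.1.2.1 i)) * g q.1 := by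
  obtain ⟨M, ⟨n, m⟩, h, hM⟩ := q
  change (∏ i : Fin n, f ((m.snoc M h hM).1 i.castSucc)) *
    g ((m.snoc M h hM).1 (Fin.last n)) = (∏ i, f (m.1 i)) * g M
  simp only [SumRange.snoc_last, SumRange.snoc_castSucc]

/-! ### Bounds for the alternating sum -/

theorem summable_prod_pi {𝕜 : Type*} [RCLike 𝕜] {n : ℕ} {F : Fin n → ℕ → 𝕜}
    (hF : ∀ i, Summable (F i)) :
    Summable (fun κ : Fin n → ℕ => ∏ i, F i (κ i)) ∧
      ∑' κ : Fin n → ℕ, ∏ i, F i (κ i) = ∏ i, ∑' k, F i k := by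
  induction n with
  | zero => exact ⟨(hasSum_fintype _).summable, by simp⟩
  | succ n ih =>
    obtain ⟨h1, h2⟩ := ih fun i => hF i.succ
    have hs := summable_mul_of_summable_norm (hF 0).norm h1.norm
    have e (p : ℕ × (Fin n → ℕ)) : ∏ i, F i (Fin.consEquiv (fun _ => ℕ) p i) =
        F 0 p.1 * ∏ i, F i.succ (p.2 i) := by
      rw [Fin.prod_univ_succ]; simp [Fin.consEquiv]
    constructor
    · rw [← (Fin.consEquiv fun _ : Fin (n + 1) => ℕ).summable_iff]
      exact hs.congr fun p => (e p).symm
    · rw [← (Fin.consEquiv fun _ : Fin (n + 1) => ℕ).tsum_eq, tsum_congr e,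
        ← tsum_mul_tsum_of_summable_norm (hF 0).norm h1.norm, h2, Fin.prod_univ_succ]

/-- The hypotheses make the coefficient at `M + 1` at most `1 / (M + 1)`, so the induction needs
only `√M + 1 / √(M + 1) ≤ √(M + 2)`. -/
theorem norm_alternatingSum_le {𝕜 : Type*} [RCLike 𝕜] {x y : 𝕜} (hx : ‖x‖ ≤ 1 / 2)
    (hy : ‖y‖ ≤ 1 / 4) (M : ℕ) :
    ‖alternatingSum (fun m : ℕ => y * (1 / (m : 𝕜) + 1 / (m - x))) M‖ ≤ √M := by
  induction M using Nat.twoStepInduction with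
  | zero => simp [alternatingSum]
  | one => simp [alternatingSum]
  | more M ih1 ih2 =>
    rw [alternatingSum]
    have h1 : ‖((M + 1 : ℕ) : 𝕜)‖ = M + 1 := by rw [RCLike.norm_natCast]; push_cast; rfl
    have h2 : (M + 1 / 2 : ℝ) ≤ ‖((M + 1 : ℕ) : 𝕜) - x‖ := by
      have := norm_sub_norm_le ((M + 1 : ℕ) : 𝕜) x
      rw [h1] at this
      linarith
    have hM : (0 : ℝ) ≤ M := M.cast_nonneg
    have h3 : ‖1 / ((M + 1 : ℕ) : 𝕜) + 1 / ((M + 1 : ℕ) - x)‖ ≤ 1 / (M + 1) + 1 / (M + 1 / 2) := by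
      refine (norm_add_le _ _).trans ?_
      rw [norm_div, norm_div, norm_one, h1]
      gcongr
    have h4 : ‖y * (1 / ((M + 1 : ℕ) : 𝕜) + 1 / ((M + 1 : ℕ) - x))‖ ≤ 1 / (M + 1) := by
      rw [norm_mul]
      have h5 : (1 / (M + 1) + 1 / (M + 1 / 2) : ℝ) ≤ 4 * (1 / (M + 1)) := by
        rw [div_add_div _ _ (by positivity) (by positivity), mul_one_div,
          div_le_div_iff₀ (by positivity) (by positivity)]
        nlinarith [mul_nonneg hM hM]
      nlinarith [norm_nonneg (1 / ((M + 1 : ℕ) : 𝕜) + 1 / ((M + 1 : ℕ) - x))]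
    have h6 : (1 / (M + 1) : ℝ) * √(M + 1) = 1 / √(M + 1) := by
      rw [one_div_mul_eq_div, Real.sqrt_div_self']
    have h7 : √M + 1 / √(M + 1) ≤ √(M + 2) := by
      have a1 := Real.sq_sqrt hM
      have a2 := Real.sq_sqrt (by linarith : (0 : ℝ) ≤ M + 1)
      have a3 := Real.sq_sqrt (by linarith : (0 : ℝ) ≤ M + 2)
      have b1 := Real.sqrt_nonneg (M : ℝ)
      have b2 : 0 < √(M + 1 : ℝ) := Real.sqrt_pos.mpr (by linarith)
      have b3 := Real.sqrt_nonneg (M + 2 : ℝ)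
      -- Concavity of the square root; the increment `√(M + 2) - √M` is 2 divided by this sum.
      have c : √(M : ℝ) + √(M + 2) ≤ 2 * √(M + 1) := by
        nlinarith [sq_nonneg (√(M : ℝ) - √(M + 2))]
      have d : 1 / √(M + 1 : ℝ) * √(M + 1) = 1 := by field_simp
      have e : (√(M + 2 : ℝ) - √M) * (√(M + 2) + √M) = 2 := by ring_nf; rw [add_comm] at a3; nlinarith
      have f0 : (√(M + 2 : ℝ) - √M) * √(M + 1) ≥ 1 := by
        have : 0 ≤ √(M + 2 : ℝ) - √M := sub_nonneg.mpr (Real.sqrt_le_sqrt (by linarith))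
        nlinarith
      have g0 : 1 / √(M + 1 : ℝ) ≤ √(M + 2) - √M := by
        rw [div_le_iff₀ b2]; exact f0
      linarith
    have h8 := norm_add_le (alternatingSum (fun m : ℕ => y * (1 / (m : 𝕜) + 1 / (m - x))) M)
      (y * (1 / ((M + 1 : ℕ) : 𝕜) + 1 / ((M + 1 : ℕ) - x)) *
        alternatingSum (fun m : ℕ => y * (1 / (m : 𝕜) + 1 / (m - x))) (M + 1))
    rw [norm_mul] at h8
    have h9 := mul_le_mul h4 ih2 (norm_nonneg _) (by positivity)
    push_cast at h6 h7 h8 h9 ⊢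
    linarith

/-- The difference `1 / (M - x) - 1 / M` decays like `M ^ (-2)`, which against growth `√M` leaves `M
^ (-3 / 2)`. -/
theorem summable_alternatingSum {𝕜 : Type*} [RCLike 𝕜] {x y : 𝕜} (hx : ‖x‖ ≤ 1 / 2)
    (hy : ‖y‖ ≤ 1 / 4) :
    Summable fun M : ℕ => alternatingSum (fun m : ℕ => y * (1 / (m : 𝕜) + 1 / (m - x))) M *
      (y * (1 / (M - x) - 1 / (M : 𝕜))) := by
  have hs : Summable fun M : ℕ => (1 : ℝ) / (M : ℝ) ^ (3 / 2 : ℝ) :=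
    Real.summable_one_div_nat_rpow.mpr (by norm_num)
  refine Summable.of_norm_bounded hs fun M => ?_
  rcases M with _ | M
  · simp [alternatingSum]
  set m : ℝ := ((M + 1 : ℕ) : ℝ) with hm
  have hm1 : 1 ≤ m := by rw [hm]; push_cast; linarith [M.cast_nonneg (α := ℝ)]
  have h1 : ‖((M + 1 : ℕ) : 𝕜)‖ = m := RCLike.norm_natCast _
  have h2 : m / 2 ≤ ‖((M + 1 : ℕ) : 𝕜) - x‖ := by
    have := norm_sub_norm_le ((M + 1 : ℕ) : 𝕜) x
    rw [h1] at this
    linarith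
  have n1 : ((M + 1 : ℕ) : 𝕜) ≠ 0 := by rw [← norm_pos_iff, h1]; linarith
  have n2 : ((M + 1 : ℕ) : 𝕜) - x ≠ 0 := by rw [← norm_pos_iff]; linarith
  have h3 : ‖y * (1 / ((M + 1 : ℕ) - x) - 1 / ((M + 1 : ℕ) : 𝕜))‖ ≤ 1 / m ^ 2 := by
    have e : y * (1 / ((M + 1 : ℕ) - x) - 1 / ((M + 1 : ℕ) : 𝕜)) =
        y * x / (((M + 1 : ℕ) - x) * ((M + 1 : ℕ) : 𝕜)) := by
      rw [div_sub_div _ _ n2 n1, mul_div_assoc]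
      congr 2
      ring
    rw [e, norm_div, norm_mul, norm_mul, h1]
    have h5 : ‖y‖ * ‖x‖ ≤ 1 / 4 * (1 / 2) := by gcongr
    have h6 : m ^ 2 / 2 ≤ ‖((M + 1 : ℕ) : 𝕜) - x‖ * m := by nlinarith
    calc ‖y‖ * ‖x‖ / (‖((M + 1 : ℕ) : 𝕜) - x‖ * m) ≤ (1 / 2) / (m ^ 2 / 2) := by
          gcongr; linarith
      _ = 1 / m ^ 2 := by field_simp
  rw [norm_mul]
  refine (mul_le_mul (norm_alternatingSum_le hx hy (M + 1)) h3 (norm_nonneg _)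
    (Real.sqrt_nonneg _)).trans (le_of_eq ?_)
  rw [← hm, Real.sqrt_eq_rpow, mul_one_div, ← Real.rpow_natCast m 2,
    ← Real.rpow_sub (by linarith), one_div (m ^ (3 / 2 : ℝ)), ← Real.rpow_neg (by linarith)]
  norm_num

/-! ### The generating function as a sum over indices and tuples -/

section Weights

variable {𝕜 : Type*} [RCLike 𝕜]

/-- The contribution of an index entry `k` and a summation variable `m` in the last position. -/
noncomputable def lastWeight (x y : 𝕜) (k m : ℕ) : 𝕜 :=
  if 2 ≤ k then y * x ^ (k - 1) / (m : 𝕜) ^ k else 0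

/-- The contribution of an index entry `k` and a summation variable `m` before the last
position. -/
noncomputable def entryWeight (x y : 𝕜) (k m : ℕ) : 𝕜 :=
  lastWeight x y k m + if k = 1 then 2 * y / m else 0

/-- The contribution of an index and a summation tuple to the generating function. -/
noncomputable def weightedTerm (x y : 𝕜) {n : ℕ} (κ : Fin (n + 1) → ℕ) (m : SumRange (n + 1)) : 𝕜 :=
  (∏ i : Fin n, entryWeight x y (κ i.castSucc) (m.1 i.castSucc)) *
    lastWeight x y (κ (Fin.last n)) (m.1 (Fin.last n))

theorem hasSum_lastWeight {x : 𝕜} (hx : ‖x‖ < 1) (y : 𝕜) {m : ℕ} (hm : 0 < m) :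
    HasSum (fun k => lastWeight x y k m) (y * (1 / (m - x) - 1 / (m : 𝕜))) := by
  have hm0 : (m : 𝕜) ≠ 0 := by exact_mod_cast hm.ne'
  have hm1 : (1 : ℝ) ≤ m := by exact_mod_cast hm
  have hq : ‖x / m‖ < 1 := by
    rw [norm_div, RCLike.norm_natCast]
    exact (div_le_self (norm_nonneg x) hm1).trans_lt hx
  have hmx : (m : 𝕜) - x ≠ 0 := by
    rw [sub_ne_zero]
    rintro rfl
    rw [RCLike.norm_natCast] at hx
    linarith
  have h := (hasSum_geometric_of_norm_lt_one hq).mul_left (y * x / (m : 𝕜) ^ 2)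
  rw [← hasSum_nat_add_iff' 2]
  have e1 : y * (1 / (m - x) - 1 / (m : 𝕜)) - ∑ i ∈ Finset.range 2, lastWeight x y i m =
      y * x / (m : 𝕜) ^ 2 * (1 - x / m)⁻¹ := by
    have h3 : (1 : 𝕜) - x / m ≠ 0 := by
      rw [one_sub_div hm0]; exact div_ne_zero hmx hm0
    simp only [Finset.sum_range_succ, Finset.sum_range_zero, lastWeight]
    norm_num
    field_simp
    ring
  rw [e1]
  refine h.congr_fun fun k => ?_
  rw [lastWeight, if_pos (by omega), show k + 2 - 1 = k + 1 by omega, div_pow]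
  field_simp
  ring

theorem hasSum_entryWeight {x : 𝕜} (hx : ‖x‖ < 1) (y : 𝕜) {m : ℕ} (hm : 0 < m) :
    HasSum (fun k => entryWeight x y k m) (y * (1 / (m : 𝕜) + 1 / (m - x))) := by
  have h := (hasSum_lastWeight hx y hm).add (hasSum_ite_eq 1 (2 * y / (m : 𝕜)))
  have e : y * (1 / (m : 𝕜) + 1 / (m - x)) = y * (1 / (m - x) - 1 / (m : 𝕜)) + 2 * y / m := by
    ring
  rw [e]
  exact h

/-- The sum of `weightedTerm` over all indices, for a fixed summation tuple. -/
noncomputable def chainTerm (x y : 𝕜) (d : Σ n, SumRange (n + 1)) : 𝕜 :=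
  (∏ i : Fin d.1, y * (1 / (d.2.1 i.castSucc : 𝕜) + 1 / (d.2.1 i.castSucc - x))) *
    (y * (1 / (d.2.1 (Fin.last d.1) - x) - 1 / (d.2.1 (Fin.last d.1) : 𝕜)))

theorem sum_chainTerm (x y : 𝕜) (M : ℕ) :
    ∑ q : Below M, chainTerm x y (sumRangeSuccEquiv ⟨M, q⟩) =
      alternatingSum (fun m : ℕ => y * (1 / (m : 𝕜) + 1 / (m - x))) M *
        (y * (1 / (M - x) - 1 / (M : 𝕜))) := by
  rw [← sum_below, Finset.sum_mul]
  exact Finset.sum_congr rfl fun q _ => prod_sumRangeSuccEquiv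
    (fun m : ℕ => y * (1 / (m : 𝕜) + 1 / (m - x))) (fun m : ℕ => y * (1 / (m - x) - 1 / (m : 𝕜)))
    ⟨M, q⟩

theorem hasSum_weightedTerm_index {x : 𝕜} (hx : ‖x‖ < 1) (y : 𝕜) {n : ℕ} (m : SumRange (n + 1)) :
    HasSum (fun κ => weightedTerm x y κ m) (chainTerm x y ⟨n, m⟩) := by
  set F : Fin (n + 1) → ℕ → 𝕜 := Fin.snoc (α := fun _ => ℕ → 𝕜)
    (fun i k => entryWeight x y k (m.1 i.castSucc))
    (fun k => lastWeight x y k (m.1 (Fin.last n))) with hF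
  have hc (i : Fin n) : F i.castSucc = fun k => entryWeight x y k (m.1 i.castSucc) := by
    rw [hF, Fin.snoc_castSucc]
  have hl : F (Fin.last n) = fun k => lastWeight x y k (m.1 (Fin.last n)) := by
    rw [hF, Fin.snoc_last]
  have hs : ∀ i, Summable (F i) := fun i => by
    induction i using Fin.lastCases with
    | last => rw [hl]; exact (hasSum_lastWeight hx y (m.2.1 _)).summable
    | cast i => rw [hc]; exact (hasSum_entryWeight hx y (m.2.1 _)).summable
  obtain ⟨h1, h2⟩ := summable_prod_pi hs
  have h3 := h1.hasSum
  rw [h2] at h3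
  simp only [Fin.prod_univ_castSucc, hc, hl, (hasSum_lastWeight hx y (m.2.1 _)).tsum_eq,
    (hasSum_entryWeight hx y (m.2.1 _)).tsum_eq] at h3
  exact h3

/-- Each entry contributes at most one monomial with nonnegative coefficient, so no cancellation
occurs. Absolute convergence thus reduces to nonnegative real `x` and `y`. -/
theorem norm_weightedTerm (x y : 𝕜) {n : ℕ} (κ : Fin (n + 1) → ℕ) (m : SumRange (n + 1)) :
    ‖weightedTerm x y κ m‖ = weightedTerm ‖x‖ ‖y‖ κ m := by
  have h1 (k m : ℕ) : ‖lastWeight x y k m‖ = lastWeight ‖x‖ ‖y‖ k m := by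
    rw [lastWeight, lastWeight]; split_ifs <;> simp
  have h2 (k m : ℕ) : ‖entryWeight x y k m‖ = entryWeight ‖x‖ ‖y‖ k m := by
    rw [entryWeight, entryWeight]
    by_cases hk : k = 1
    · subst hk; simp [lastWeight]
    · simp only [hk, if_false, add_zero]; exact h1 k m
  rw [weightedTerm, weightedTerm, norm_mul, norm_prod, h1]
  simp only [h2]

end Weights

theorem weightedTerm_nonneg {x y : ℝ} (hx : 0 ≤ x) (hy : 0 ≤ y) {n : ℕ} (κ : Fin (n + 1) → ℕ)
    (m : SumRange (n + 1)) : 0 ≤ weightedTerm x y κ m := by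
  have := norm_weightedTerm x y κ m
  rw [Real.norm_of_nonneg hx, Real.norm_of_nonneg hy] at this
  rw [← this]
  exact norm_nonneg _

theorem summable_chainTerm_real {x y : ℝ} (hx : 0 ≤ x) (hx' : x ≤ 1 / 2) (hy : 0 ≤ y)
    (hy' : y ≤ 1 / 4) : Summable fun d : (Σ n, SumRange (n + 1)) => chainTerm x y d := by
  have nx : ‖x‖ ≤ 1 / 2 := by rwa [Real.norm_of_nonneg hx]
  have ny : ‖y‖ ≤ 1 / 4 := by rwa [Real.norm_of_nonneg hy]
  have nx1 : ‖x‖ < 1 := nx.trans_lt (by norm_num)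
  rw [← sumRangeSuccEquiv.summable_iff]
  refine (summable_sigma_of_nonneg ?_).mpr ⟨?_, ?_⟩
  · intro q
    rw [Function.comp_apply]
    generalize sumRangeSuccEquiv q = d
    rw [← (hasSum_weightedTerm_index nx1 y d.2).tsum_eq]
    exact tsum_nonneg fun κ => weightedTerm_nonneg hx hy κ _
  · exact fun M => (hasSum_fintype _).summable
  · refine (summable_alternatingSum nx ny).congr fun M => ?_
    rw [tsum_fintype, ← sum_chainTerm]
    rfl

theorem summable_weightedTerm_real {x y : ℝ} (hx : 0 ≤ x) (hx' : x ≤ 1 / 2) (hy : 0 ≤ y)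
    (hy' : y ≤ 1 / 4) :
    Summable fun p : Σ d : (Σ n, SumRange (n + 1)), (Fin (d.1 + 1) → ℕ) =>
      weightedTerm x y p.2 p.1.2 := by
  have nx1 : ‖x‖ < 1 := by rw [Real.norm_of_nonneg hx]; linarith
  refine (summable_sigma_of_nonneg ?_).mpr ⟨?_, ?_⟩
  · exact fun p => weightedTerm_nonneg hx hy p.2 p.1.2
  · exact fun d => (hasSum_weightedTerm_index nx1 y d.2).summable
  · exact (summable_chainTerm_real hx hx' hy hy').congr
      fun d => (hasSum_weightedTerm_index nx1 y d.2).tsum_eq.symm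

/-- Absolute convergence permits summing over indices first, then over tuples grouped by their last
entry. -/
theorem hasSum_weightedTerm {x y : ℂ} (hx : ‖x‖ ≤ 1 / 2) (hy : ‖y‖ ≤ 1 / 4) :
    HasSum (fun p : Σ d : (Σ n, SumRange (n + 1)), (Fin (d.1 + 1) → ℕ) =>
      weightedTerm x y p.2 p.1.2)
      (∑' M : ℕ, alternatingSum (fun m : ℕ => y * (1 / (m : ℂ) + 1 / (m - x))) M *
        (y * (1 / (M - x) - 1 / (M : ℂ)))) := by
  have nx1 : ‖x‖ < 1 := hx.trans_lt (by norm_num)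
  have hs : Summable fun p : Σ d : (Σ n, SumRange (n + 1)), (Fin (d.1 + 1) → ℕ) =>
      weightedTerm x y p.2 p.1.2 := by
    refine Summable.of_norm ?_
    simp_rw [norm_weightedTerm]
    exact summable_weightedTerm_real (norm_nonneg x) hx (norm_nonneg y) hy
  have h1 := hs.hasSum.sigma fun d => hasSum_weightedTerm_index nx1 y d.2
  have h2 := sumRangeSuccEquiv.hasSum_iff.mpr h1
  have h3 := h2.sigma fun M => hasSum_fintype fun q : Below M =>
    chainTerm x y (sumRangeSuccEquiv ⟨M, q⟩)
  simp_rw [sum_chainTerm] at h3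
  rw [h3.tsum_eq]
  exact hs.hasSum

/-! ### Regrouping by weight and depth -/

open Classical in
/-- The coefficient `2 ^ (-height)` of an admissible index, and `0` for other tuples. -/
noncomputable def indexCoeff {n : ℕ} (κ : Fin n → ℕ) : ℝ :=
  if IsIndex κ ∧ IsAdmissible κ then 1 / 2 ^ height κ else 0

theorem isAdmissible_succ {n : ℕ} {κ : Fin (n + 1) → ℕ} :
    IsAdmissible κ ↔ 2 ≤ κ (Fin.last n) := by
  constructor
  · rintro ⟨j, hj, h⟩
    rwa [show j = Fin.last n from Fin.ext (by simpa using hj)] at h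
  · exact fun h => ⟨Fin.last n, by simp, h⟩

theorem depth_lt_weight {n : ℕ} {κ : Fin n → ℕ} (h : IsIndex κ) (ha : IsAdmissible κ) :
    n < weight κ := by
  obtain ⟨j, -, hj⟩ := ha
  have : ∑ i : Fin n, 1 < ∑ i, κ i :=
    Finset.sum_lt_sum (fun i _ => h i) ⟨j, Finset.mem_univ j, hj⟩
  simpa [weight] using this

/-- Pulling `2 y` out of every position leaves a factor `1 / 2` for each entry at least two, hence
`2 ^ (-height)`. Tuples that are not admissible indices contribute zero, which allows free summation
over all natural tuples. -/
theorem weightedTerm_eq (x y : ℂ) {n : ℕ} (κ : Fin (n + 1) → ℕ) (m : SumRange (n + 1)) :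
    weightedTerm x y κ m =
      (indexCoeff κ * 2 ^ (n + 1) * x ^ (weight κ - (n + 1)) * y ^ (n + 1)) * (term κ m : ℂ) := by
  by_cases hadm : 2 ≤ κ (Fin.last n)
  swap
  · rw [weightedTerm, lastWeight, if_neg hadm, indexCoeff,
      if_neg fun h => hadm (isAdmissible_succ.mp h.2)]
    simp
  by_cases hidx : IsIndex κ
  swap
  · rw [indexCoeff, if_neg fun h => hidx h.1]
    simp only [IsIndex, not_forall] at hidx
    obtain ⟨j, hj⟩ := hidx
    induction j using Fin.lastCases with
    | last => omega
    | cast j =>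
      have h0 : κ j.castSucc = 0 := by omega
      rw [weightedTerm, Finset.prod_eq_zero (Finset.mem_univ j) (by simp [entryWeight, lastWeight, h0])]
      simp
  have hentry (i : Fin (n + 1)) : lastWeight x y (κ i) (m.1 i) + (if κ i = 1 then 2 * y / m.1 i else 0)
      = (if 2 ≤ κ i then 1 / 2 else 1) * (2 * y) * x ^ (κ i - 1) * (1 / (m.1 i : ℂ) ^ κ i) := by
    rw [lastWeight]
    rcases (hidx i).lt_or_eq with h | h
    · rw [if_pos (by omega), if_neg (by omega), if_pos (by omega)]
      ring
    · rw [if_neg (by omega), if_pos h.symm, if_neg (by omega), ← h]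
      simp
      ring
  have hlast := hentry (Fin.last n)
  rw [if_neg (by omega), add_zero] at hlast
  have hheight : ∏ i, (if 2 ≤ κ i then (1 / 2 : ℂ) else 1) = 1 / 2 ^ height κ := by
    rw [Finset.prod_ite, Finset.prod_const, Finset.prod_const_one, mul_one, height, one_div_pow]
  have hweight : ∏ i, x ^ (κ i - 1) = x ^ (weight κ - (n + 1)) := by
    rw [Finset.prod_pow_eq_pow_sum, Finset.sum_tsub_distrib _ fun i _ => hidx i]
    simp [weight]
  have hy : ∏ _i : Fin (n + 1), (2 * y) = 2 ^ (n + 1) * y ^ (n + 1) := by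
    rw [Finset.prod_const, mul_pow]; simp
  rw [weightedTerm, hlast]
  simp only [entryWeight, hentry]
  rw [← Fin.prod_univ_castSucc (fun i : Fin (n + 1) => (if 2 ≤ κ i then (1 / 2 : ℂ) else 1) *
    (2 * y) * x ^ (κ i - 1) * (1 / (m.1 i : ℂ) ^ κ i)), Finset.prod_mul_distrib,
    Finset.prod_mul_distrib, Finset.prod_mul_distrib, hheight, hweight, hy, indexCoeff,
    if_pos ⟨hidx, isAdmissible_succ.mpr hadm⟩, term]
  push_cast
  ring

/-- Reordering of the summation over tuples and indices. -/
def sumRangeIndexEquiv : (Σ d : (Σ n, SumRange (n + 1)), (Fin (d.1 + 1) → ℕ)) ≃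
    Σ d : (Σ n, (Fin (n + 1) → ℕ)), SumRange (d.1 + 1) where
  toFun p := ⟨⟨p.1.1, p.2⟩, p.1.2⟩
  invFun p := ⟨⟨p.1.1, p.2⟩, p.1.2⟩
  left_inv _ := rfl
  right_inv _ := rfl

/-- Indices sorted by weight and depth. -/
def indexEquiv : (Σ p : ℕ × ℕ, {κ : Fin (p.2 + 1) → ℕ // weight κ = p.1}) ≃
    Σ n, (Fin (n + 1) → ℕ) where
  toFun q := ⟨q.1.2, q.2.1⟩
  invFun q := ⟨(weight q.2, q.1), ⟨q.2, rfl⟩⟩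
  left_inv := by
    rintro ⟨⟨k, n⟩, κ, h⟩
    revert κ
    intro (κ : Fin (n + 1) → ℕ) (h : weight κ = k)
    subst h
    rfl
  right_inv _ := rfl

theorem summable_term {n : ℕ} {κ : Fin n → ℕ} (hidx : IsIndex κ) (hadm : IsAdmissible κ) :
    Summable fun m : SumRange n => term κ m := by
  rcases n with _ | n
  · exact (hasSum_fintype _).summable
  -- Any nonzero point of the region serves: the part of the summable family belonging to `κ` is a
  -- nonzero multiple of its T-series.
  have h := (hasSum_weightedTerm (x := (1 / 4 : ℂ)) (y := (1 / 8 : ℂ)) (by norm_num)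
    (by norm_num)).summable
  have h1 := (sumRangeIndexEquiv.symm.summable_iff.mpr h).sigma_factor ⟨n, κ⟩
  have h2 : Summable fun m : SumRange (n + 1) => weightedTerm (1 / 4 : ℂ) (1 / 8 : ℂ) κ m := h1
  simp_rw [weightedTerm_eq] at h2
  rw [summable_mul_left_iff] at h2
  · exact Complex.summable_ofReal.mp h2
  · rw [indexCoeff, if_pos ⟨hidx, hadm⟩]
    simp

theorem sum_indexCoeff (k n : ℕ) :
    ∑ κ ∈ Finset.piAntidiag (Finset.univ : Finset (Fin n)) k, indexCoeff κ * T κ =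
      weightedSum k n := by
  classical
  simp only [weightedSum, admissibleIndices, indices, Finset.filter_filter, Finset.sum_filter,
    Finset.mul_sum]
  rw [Finset.sum_comm]
  refine Finset.sum_congr rfl fun κ _ => ?_
  rw [indexCoeff]
  by_cases h : IsIndex κ ∧ IsAdmissible κ
  · have hh : height κ ∈ Finset.Icc 1 n := by
      obtain ⟨j, -, hj⟩ := h.2
      refine Finset.mem_Icc.mpr ⟨Finset.card_pos.mpr ⟨j, by simpa using hj⟩, ?_⟩
      exact (Finset.card_le_univ _).trans (by simp)
    rw [if_pos h, Finset.sum_eq_single_of_mem _ hh]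
    · rw [if_pos ⟨⟨h.1, rfl⟩, h.2⟩]
    · intro s _ hs
      rw [if_neg (fun h' => hs h'.1.2.symm), mul_zero]
  · rw [if_neg h, zero_mul]
    refine (Finset.sum_eq_zero fun s _ => ?_).symm
    rw [if_neg (fun h' => h ⟨h'.1.1, h'.2⟩), mul_zero]

theorem weightedSum_eq_zero {k n : ℕ} (h : k ≤ n) : weightedSum k n = 0 := by
  rw [← sum_indexCoeff]
  refine Finset.sum_eq_zero fun κ hκ => ?_
  rw [indexCoeff, if_neg, zero_mul]
  rintro ⟨h1, h2⟩
  have h3 := depth_lt_weight h1 h2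
  rw [weight, (Finset.mem_piAntidiag.mp hκ).1] at h3
  omega

theorem hasSum_weightedSum {x y : ℂ} (hx : ‖x‖ ≤ 1 / 2) (hy : ‖y‖ ≤ 1 / 4) :
    HasSum (fun p : {p : ℕ × ℕ // p.2 < p.1 ∧ 1 ≤ p.2} =>
        (weightedSum p.1.1 p.1.2 : ℂ) * x ^ (p.1.1 - p.1.2) * y ^ p.1.2)
      (∑' M : ℕ, alternatingSum (fun m : ℕ => y * (1 / (m : ℂ) + 1 / (m - x))) M *
        (y * (1 / (M - x) - 1 / (M : ℂ)))) := by
  set S := ∑' M : ℕ, alternatingSum (fun m : ℕ => y * (1 / (m : ℂ) + 1 / (m - x))) M *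
        (y * (1 / (M - x) - 1 / (M : ℂ)))
  have h1 := sumRangeIndexEquiv.symm.hasSum_iff.mpr (hasSum_weightedTerm hx hy)
  have h2 : HasSum (fun d : (Σ n, (Fin (n + 1) → ℕ)) => ((indexCoeff d.2 * T d.2 : ℝ) : ℂ) *
      x ^ (weight d.2 - (d.1 + 1)) * y ^ (d.1 + 1)) S := by
    refine h1.sigma fun d => ?_
    have e : HasSum (fun m => weightedTerm x y d.2 m) (((indexCoeff d.2 * T d.2 : ℝ) : ℂ) *
      x ^ (weight d.2 - (d.1 + 1)) * y ^ (d.1 + 1)) := by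
      simp_rw [weightedTerm_eq]
      by_cases h : IsIndex d.2 ∧ IsAdmissible d.2
      · have h3 := (Complex.hasSum_ofReal.mpr (summable_term h.1 h.2).hasSum).mul_left
          (indexCoeff d.2 * 2 ^ (d.1 + 1) * x ^ (weight d.2 - (d.1 + 1)) * y ^ (d.1 + 1) : ℂ)
        have e1 : ((indexCoeff d.2 * T d.2 : ℝ) : ℂ) *
            x ^ (weight d.2 - (d.1 + 1)) * y ^ (d.1 + 1) =
            (indexCoeff d.2 * 2 ^ (d.1 + 1) * x ^ (weight d.2 - (d.1 + 1)) * y ^ (d.1 + 1) : ℂ) *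
              ((∑' m : SumRange (d.1 + 1), term d.2 m : ℝ) : ℂ) := by
          rw [T]
          push_cast
          ring
        rw [e1]
        exact h3
      · have h0 : indexCoeff d.2 = 0 := by rw [indexCoeff, if_neg h]
        rw [h0]
        simp
    exact e
  have h3 := indexEquiv.hasSum_iff.mpr h2
  have h4 : HasSum (fun p : ℕ × ℕ => (weightedSum p.1 (p.2 + 1) : ℂ) * x ^ (p.1 - (p.2 + 1)) *
      y ^ (p.2 + 1)) S := by
    refine h3.sigma fun p => ?_
    have e : HasSum (fun κ : {κ : Fin (p.2 + 1) → ℕ // weight κ = p.1} =>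
        ((indexCoeff κ.1 * T κ.1 : ℝ) : ℂ) * (x ^ (p.1 - (p.2 + 1)) * y ^ (p.2 + 1)))
        ((weightedSum p.1 (p.2 + 1) : ℂ) * (x ^ (p.1 - (p.2 + 1)) * y ^ (p.2 + 1))) := by
      refine HasSum.mul_right _ (Complex.hasSum_ofReal.mpr ?_)
      rw [← sum_indexCoeff]
      have h5 := Finset.hasSum (Finset.piAntidiag (Finset.univ : Finset (Fin (p.2 + 1))) p.1)
        (fun κ => indexCoeff κ * T κ)
      exact (Equiv.subtypeEquivRight fun κ : Fin (p.2 + 1) → ℕ => by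
        simp [weight, Finset.mem_piAntidiag]).hasSum_iff.mpr h5
    rw [mul_assoc]
    refine e.congr_fun fun κ => ?_
    obtain ⟨κ, hκ⟩ := κ
    show ((indexCoeff κ * T κ : ℝ) : ℂ) * x ^ (weight κ - (p.2 + 1)) * y ^ (p.2 + 1) = _
    rw [hκ, mul_assoc]
  -- So far `p.2` was the depth minus one and the weight was unrestricted. Pairs outside the image
  -- have weight at most the depth, where `weightedSum` vanishes.
  have hinj : Function.Injective fun p : {p : ℕ × ℕ // p.2 < p.1 ∧ 1 ≤ p.2} =>
      (p.1.1, p.1.2 - 1) := by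
    rintro ⟨⟨k, n⟩, h, h'⟩ ⟨⟨k', n'⟩, g, g'⟩ e
    simp only [Prod.mk.injEq] at e h' g'
    simp only [Subtype.mk.injEq, Prod.mk.injEq]
    omega
  refine ((hinj.hasSum_iff ?_).mpr h4).congr_fun ?_
  · rintro ⟨k, n⟩ hp
    have : k ≤ n + 1 := by
      by_contra hlt
      exact hp ⟨⟨(k, n + 1), by simp; omega⟩, by simp⟩
    simp [weightedSum_eq_zero this]
  · rintro ⟨⟨k, n⟩, h, h'⟩
    simp only [Function.comp_apply] at h' ⊢
    rw [Nat.sub_add_cancel h']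

theorem one_sub_tsum_weightedSum {x y : ℂ} (hx : ‖x‖ < 1 / 2) (hy : ‖y‖ < 1 / 4) :
    1 - ∑' p : {p : ℕ × ℕ // p.2 < p.1 ∧ 1 ≤ p.2},
        (weightedSum p.1.1 p.1.2 : ℂ) * x ^ (p.1.1 - p.1.2) * y ^ p.1.2 =
      Complex.exp (∑' n : {n : ℕ // 2 ≤ n},
        (T ![n.1] : ℂ) / (2 * (n.1 : ℂ)) * (x ^ n.1 + y ^ n.1 - (x + y) ^ n.1)) := by
  have hs := summable_alternatingSum hx.le hy.le
  have hs1 := (summable_nat_add_iff 1).mpr hs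
  simp_rw [mul_comm (alternatingSum _ _)] at hs1
  rw [exp_exponent hx hy, ← one_sub_tsum_alternatingSum hx hy hs1,
    (hasSum_weightedSum hx.le hy.le).tsum_eq, hs.tsum_eq_zero_add]
  simp [alternatingSum, mul_comm]

/-! ### From the analytic identity to formal power series -/

/-- The value of the monomial with exponent `d` at the point `(x, y)`. -/
noncomputable def monomialValue (x y : ℝ) (d : Fin 2 →₀ ℕ) : ℝ := x ^ d 0 * y ^ d 1

theorem monomialValue_add (x y : ℝ) (d e : Fin 2 →₀ ℕ) :
    monomialValue x y (d + e) = monomialValue x y d * monomialValue x y e := by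
  simp only [monomialValue, Finsupp.add_apply, pow_add]
  ring

/-- The terms of a power series in two variables, evaluated at `(x, y)`. -/
noncomputable def seriesTerm (x y : ℝ) (F : MvPowerSeries (Fin 2) ℝ) (d : Fin 2 →₀ ℕ) : ℝ :=
  MvPowerSeries.coeff d F * monomialValue x y d

theorem seriesTerm_mul (x y : ℝ) (F G : MvPowerSeries (Fin 2) ℝ) (d : Fin 2 →₀ ℕ) :
    seriesTerm x y (F * G) d =
      ∑ e ∈ Finset.HasAntidiagonal.antidiagonal d, seriesTerm x y F e.1 * seriesTerm x y G e.2 := by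
  rw [seriesTerm, MvPowerSeries.coeff_mul, Finset.sum_mul]
  refine Finset.sum_congr rfl fun e he => ?_
  rw [← Finset.HasAntidiagonal.mem_antidiagonal.mp he, monomialValue_add, seriesTerm, seriesTerm]
  ring

theorem hasSum_antidiagonal {ι : Type*} [AddCommMonoid ι] [Finset.HasAntidiagonal ι]
    {f g : ι → ℝ} {a b : ℝ} (hf : HasSum f a) (hg : HasSum g b) :
    HasSum (fun d => ∑ e ∈ Finset.HasAntidiagonal.antidiagonal d, f e.1 * g e.2) (a * b) ∧
      ∑' d, |∑ e ∈ Finset.HasAntidiagonal.antidiagonal d, f e.1 * g e.2| ≤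
        (∑' d, |f d|) * ∑' d, |g d| := by
  have hprod := summable_mul_of_summable_norm hf.summable.norm hg.summable.norm
  have habs : Summable fun p : ι × ι => |f p.1| * |g p.2| :=
    hf.summable.abs.mul_of_nonneg hg.summable.abs (fun d => abs_nonneg _) (fun d => abs_nonneg _)
  have hsum := summable_sum_mul_antidiagonal_of_summable_mul hprod
  constructor
  · rw [← hf.tsum_eq, ← hg.tsum_eq,
      hf.summable.tsum_mul_tsum_eq_tsum_sum_antidiagonal hg.summable hprod]
    exact hsum.hasSum
  · rw [hf.summable.abs.tsum_mul_tsum_eq_tsum_sum_antidiagonal hg.summable.abs habs]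
    refine hsum.abs.tsum_le_tsum (fun d => ?_)
      (summable_sum_mul_antidiagonal_of_summable_mul (f := fun d => |f d|) (g := fun d => |g d|) habs)
    refine (Finset.abs_sum_le_sum_abs _ _).trans (le_of_eq ?_)
    simp_rw [abs_mul]

theorem hasSum_seriesTerm_pow {x y a A : ℝ} {G : MvPowerSeries (Fin 2) ℝ}
    (hG : HasSum (seriesTerm x y G) a) (hA : ∑' d, |seriesTerm x y G d| ≤ A) (k : ℕ) :
    HasSum (seriesTerm x y (G ^ k)) (a ^ k) ∧ ∑' d, |seriesTerm x y (G ^ k) d| ≤ A ^ k := by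
  have hA0 : 0 ≤ A := (tsum_nonneg fun d => abs_nonneg _).trans hA
  induction k with
  | zero =>
    have h (d : Fin 2 →₀ ℕ) : seriesTerm x y (G ^ 0) d = if d = 0 then 1 else 0 := by
      classical
      rw [pow_zero, seriesTerm, MvPowerSeries.coeff_one]
      split_ifs with h
      · simp [h, monomialValue]
      · simp
    constructor
    · rw [funext h, pow_zero]
      exact hasSum_ite_eq 0 1
    · simp_rw [h]
      rw [tsum_eq_single 0 (by intro d hd; simp [hd])]
      simp
  | succ k ih =>
    obtain ⟨h1, h2⟩ := hasSum_antidiagonal ih.1 hG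
    have hterm := (funext (seriesTerm_mul x y (G ^ k) G)).symm
    rw [hterm] at h1
    simp_rw [← seriesTerm_mul] at h2
    rw [pow_succ, pow_succ, pow_succ]
    exact ⟨h1, h2.trans (mul_le_mul ih.2 hA (tsum_nonneg fun d => abs_nonneg _) (by positivity))⟩

/-- Evaluation commutes with formal substitution because the sum of absolute values of the terms is
submultiplicative: `G ^ k` is bounded by `A ^ k`, so the double series over `k` and monomials
converges absolutely. -/
theorem hasSum_seriesTerm_subst {x y a A : ℝ} {G : MvPowerSeries (Fin 2) ℝ} {f : PowerSeries ℝ}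
    (h0 : MvPowerSeries.constantCoeff G = 0) (hG : HasSum (seriesTerm x y G) a)
    (hA : ∑' d, |seriesTerm x y G d| ≤ A)
    (hf : Summable fun k => |PowerSeries.coeff k f| * A ^ k) :
    HasSum (seriesTerm x y (f.subst G)) (∑' k, PowerSeries.coeff k f * a ^ k) := by
  have hsub : PowerSeries.HasSubst G := PowerSeries.HasSubst.of_constantCoeff_zero h0
  set u : ℕ × (Fin 2 →₀ ℕ) → ℝ := fun p =>
    PowerSeries.coeff p.1 f * seriesTerm x y (G ^ p.1) p.2 with hu
  have hpow := hasSum_seriesTerm_pow hG hA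
  have hsum : Summable u := by
    refine Summable.of_norm ((summable_prod_of_nonneg fun p => norm_nonneg _).mpr ⟨fun k => ?_, ?_⟩)
    · simp only [hu]
      exact ((hpow k).1.summable.mul_left _).norm
    · refine Summable.of_nonneg_of_le (fun k => tsum_nonneg fun d => norm_nonneg _) (fun k => ?_) hf
      simp only [hu, Real.norm_eq_abs, abs_mul, tsum_mul_left]
      exact mul_le_mul_of_nonneg_left (hpow k).2 (abs_nonneg _)
  have h1 : HasSum u (∑' k, PowerSeries.coeff k f * a ^ k) := by
    rw [← tsum_congr fun k => ((hpow k).1.mul_left (PowerSeries.coeff k f)).tsum_eq,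
      ← hsum.tsum_prod]
    exact hsum.hasSum
  have h2 := (Equiv.prodComm (Fin 2 →₀ ℕ) ℕ).hasSum_iff.mpr h1
  refine h2.prod_fiberwise fun d => ?_
  have hfin := PowerSeries.coeff_subst_finite hsub f d
  rw [seriesTerm, PowerSeries.coeff_subst hsub, ← tsum_eq_finsum (L := SummationFilter.unconditional ℕ) hfin]
  have h3 : HasSum (fun k => PowerSeries.coeff k f • MvPowerSeries.coeff d (G ^ k))
      (∑' k, PowerSeries.coeff k f • MvPowerSeries.coeff d (G ^ k)) :=
    (summable_of_hasFiniteSupport hfin).hasSum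
  refine (h3.mul_right (monomialValue x y d)).congr_fun fun k => ?_
  simp only [hu, Function.comp_apply, Equiv.prodComm_apply, Prod.swap, seriesTerm, smul_eq_mul]
  ring

theorem hasSum_seriesTerm_X (x y : ℝ) (i : Fin 2) :
    HasSum (seriesTerm x y (MvPowerSeries.X i)) (if i = 0 then x else y) := by
  classical
  have h : seriesTerm x y (MvPowerSeries.X i) = fun d =>
      if d = Finsupp.single i 1 then (if i = 0 then x else y) else 0 := by
    funext d
    rw [seriesTerm, MvPowerSeries.coeff_X]
    split_ifs with h1 h2
    · subst h1 h2; simp [monomialValue]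
    · obtain rfl : i = 1 := by omega
      subst h1; simp [monomialValue]
    · simp
  rw [h]
  exact hasSum_ite_eq _ _

theorem T_depth_one_le {n : ℕ} (hn : 2 ≤ n) : 0 ≤ T ![n] ∧ T ![n] ≤ T ![2] := by
  rw [T_depth_one, T_depth_one]
  refine ⟨mul_nonneg (by norm_num) (tsum_nonneg fun j => by positivity), ?_⟩
  refine mul_le_mul_of_nonneg_left ?_ (by norm_num)
  refine (summable_one_div_odd_pow hn).tsum_le_tsum (fun j => ?_) (summable_one_div_odd_pow le_rfl)
  exact one_div_le_one_div_of_le (by positivity) (pow_le_pow_right₀ (by simp) hn)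

theorem summable_depthOneSeries {A : ℝ} (hA : 0 ≤ A) (hA1 : A < 1) :
    Summable fun k => |PowerSeries.coeff k depthOneSeries| * A ^ k := by
  refine Summable.of_nonneg_of_le (fun k => by positivity) (fun k => ?_)
    ((summable_geometric_of_lt_one hA hA1).mul_left (T ![2]))
  refine mul_le_mul_of_nonneg_right ?_ (by positivity)
  rw [depthOneSeries, PowerSeries.coeff_mk]
  split_ifs with h
  · obtain ⟨h1, h2⟩ := T_depth_one_le h
    have hk : (1 : ℝ) ≤ 2 * k := by
      have : (2 : ℝ) ≤ k := by exact_mod_cast h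
      linarith
    rw [abs_of_nonneg (by positivity)]
    exact (div_le_self h1 hk).trans h2
  · rw [abs_zero]
    exact (T_depth_one_le le_rfl).1

theorem seriesTerm_nonneg_X {x y : ℝ} (hx : 0 ≤ x) (hy : 0 ≤ y) (i : Fin 2) (d : Fin 2 →₀ ℕ) :
    0 ≤ seriesTerm x y (MvPowerSeries.X i) d := by
  classical
  rw [seriesTerm, MvPowerSeries.coeff_X, monomialValue]
  split_ifs <;> positivity

theorem constantCoeff_exponentSeries : MvPowerSeries.constantCoeff exponentSeries = 0 := by
  have h : PowerSeries.constantCoeff depthOneSeries = 0 := by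
    rw [← PowerSeries.coeff_zero_eq_constantCoeff_apply, depthOneSeries, PowerSeries.coeff_mk]
    simp
  have hX (i : Fin 2) : MvPowerSeries.constantCoeff (MvPowerSeries.X i : MvPowerSeries (Fin 2) ℝ) = 0 :=
    MvPowerSeries.constantCoeff_X i
  rw [exponentSeries, map_sub, map_add, PowerSeries.constantCoeff_subst_eq_zero (hX 0) _ h,
    PowerSeries.constantCoeff_subst_eq_zero (hX 1) _ h,
    PowerSeries.constantCoeff_subst_eq_zero (by rw [map_add, hX, hX, add_zero]) _ h]
  simp

/-- For nonnegative `x` and `y` the absolute term sum of `X 0 + X 1` is `x + y` itself, so `x + y <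
1` suffices for all three substitutions. -/
theorem hasSum_exponentSeries {x y : ℝ} (hx : 0 ≤ x) (hy : 0 ≤ y) (hxy : x + y < 1) :
    HasSum (seriesTerm x y exponentSeries)
      (∑' k, PowerSeries.coeff k depthOneSeries * (x ^ k + y ^ k - (x + y) ^ k)) := by
  have hx1 : x < 1 := by linarith
  have hy1 : y < 1 := by linarith
  have e0 := hasSum_seriesTerm_X x y 0
  have e1 := hasSum_seriesTerm_X x y 1
  rw [if_pos rfl] at e0
  rw [if_neg one_ne_zero] at e1
  have hadd (F G : MvPowerSeries (Fin 2) ℝ) (d) :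
      seriesTerm x y (F + G) d = seriesTerm x y F d + seriesTerm x y G d := by
    rw [seriesTerm, map_add, add_mul, seriesTerm, seriesTerm]
  have hsub (F G : MvPowerSeries (Fin 2) ℝ) (d) :
      seriesTerm x y (F - G) d = seriesTerm x y F d - seriesTerm x y G d := by
    rw [seriesTerm, map_sub, sub_mul, seriesTerm, seriesTerm]
  have e2 : HasSum (seriesTerm x y (MvPowerSeries.X 0 + MvPowerSeries.X 1)) (x + y) :=
    (e0.add e1).congr_fun (hadd _ _)
  have hnn (i : Fin 2) (d) := seriesTerm_nonneg_X hx hy i d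
  have c0 := MvPowerSeries.constantCoeff_X (R := ℝ) (0 : Fin 2)
  have c1 := MvPowerSeries.constantCoeff_X (R := ℝ) (1 : Fin 2)
  have s0 := hasSum_seriesTerm_subst c0 e0
    (by simp_rw [abs_of_nonneg (hnn 0 _)]; exact e0.tsum_eq.le) (summable_depthOneSeries hx hx1)
  have s1 := hasSum_seriesTerm_subst c1 e1
    (by simp_rw [abs_of_nonneg (hnn 1 _)]; exact e1.tsum_eq.le) (summable_depthOneSeries hy hy1)
  have s2 := hasSum_seriesTerm_subst (by rw [map_add, c0, c1, add_zero]) e2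
    (by
      have hd (d : Fin 2 →₀ ℕ) : 0 ≤ seriesTerm x y (MvPowerSeries.X 0 + MvPowerSeries.X 1) d := by
        rw [hadd]; exact add_nonneg (hnn 0 d) (hnn 1 d)
      simp_rw [abs_of_nonneg (hd _)]; exact e2.tsum_eq.le)
    (summable_depthOneSeries (add_nonneg hx hy) hxy)
  have sm {z : ℝ} (hz : 0 ≤ z) (hz1 : z < 1) :
      Summable fun k => PowerSeries.coeff k depthOneSeries * z ^ k := by
    refine Summable.of_norm ((summable_depthOneSeries hz hz1).congr fun k => ?_)
    rw [norm_mul, Real.norm_eq_abs, Real.norm_of_nonneg (by positivity)]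
  simp_rw [mul_sub, mul_add]
  rw [((sm hx hx1).add (sm hy hy1)).tsum_sub (sm (add_nonneg hx hy) hxy),
    (sm hx hx1).tsum_add (sm hy hy1)]
  exact ((s0.add s1).sub s2).congr_fun fun d => by rw [exponentSeries, hsub, hadd]

theorem hasSum_exp_exponentSeries {x y : ℝ} (hx : 0 ≤ x) (hy : 0 ≤ y) (hxy : x + y < 1) :
    HasSum (seriesTerm x y ((PowerSeries.exp ℝ).subst exponentSeries))
      (Real.exp (∑' k, PowerSeries.coeff k depthOneSeries * (x ^ k + y ^ k - (x + y) ^ k))) := by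
  have h := hasSum_seriesTerm_subst (f := PowerSeries.exp ℝ) constantCoeff_exponentSeries
    (hasSum_exponentSeries hx hy hxy) le_rfl (by
      refine (Real.summable_pow_div_factorial
        (∑' d, |seriesTerm x y exponentSeries d|)).congr fun k => ?_
      rw [PowerSeries.coeff_exp, map_div₀, map_one, map_natCast, abs_of_nonneg (by positivity)]
      ring)
  rw [Real.exp_eq_exp_ℝ, NormedSpace.exp_eq_tsum_div]
  have e (z : ℝ) (k : ℕ) : z ^ k / k.factorial = PowerSeries.coeff k (PowerSeries.exp ℝ) * z ^ k := by
    rw [PowerSeries.coeff_exp, map_div₀, map_one, map_natCast]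
    ring
  simp_rw [e]
  exact h

theorem exponent_ofReal (x y : ℝ) :
    ((∑' k, PowerSeries.coeff k depthOneSeries * (x ^ k + y ^ k - (x + y) ^ k) : ℝ) : ℂ) =
      ∑' n : {n : ℕ // 2 ≤ n},
        (T ![n.1] : ℂ) / (2 * (n.1 : ℂ)) * ((x : ℂ) ^ n.1 + (y : ℂ) ^ n.1 - (x + y) ^ n.1) := by
  rw [Complex.ofReal_tsum, ← tsum_subtype_eq_of_support_subset (s := {n : ℕ | 2 ≤ n})]
  · refine tsum_congr fun n => ?_
    have hn : 2 ≤ n.1 := n.2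
    rw [depthOneSeries, PowerSeries.coeff_mk, if_pos hn]
    push_cast
    rfl
  · intro k hk
    by_contra hlt
    apply hk
    have : ¬ 2 ≤ k := hlt
    simp only [depthOneSeries, PowerSeries.coeff_mk, if_neg this, zero_mul, Complex.ofReal_zero]

theorem hasSum_weightedSeries {x y : ℝ} (hx : |x| ≤ 1 / 2) (hy : |y| ≤ 1 / 4) :
    HasSum (seriesTerm x y weightedSeries)
      (∑' p : {p : ℕ × ℕ // p.2 < p.1 ∧ 1 ≤ p.2},
        weightedSum p.1.1 p.1.2 * x ^ (p.1.1 - p.1.2) * y ^ p.1.2) := by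
  have h := (hasSum_weightedSum (x := x) (y := y) (by simpa using hx) (by simpa using hy)).summable
  have h1 : Summable fun p : {p : ℕ × ℕ // p.2 < p.1 ∧ 1 ≤ p.2} =>
      weightedSum p.1.1 p.1.2 * x ^ (p.1.1 - p.1.2) * y ^ p.1.2 := by
    rw [← Complex.summable_ofReal]
    exact h.congr fun p => by push_cast; rfl
  set i : {p : ℕ × ℕ // p.2 < p.1 ∧ 1 ≤ p.2} → (Fin 2 →₀ ℕ) := fun p =>
    Finsupp.equivFunOnFinite.symm ![p.1.1 - p.1.2, p.1.2] with hi
  have i0 (p) : i p 0 = p.1.1 - p.1.2 := rfl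
  have i1 (p) : i p 1 = p.1.2 := rfl
  have hinj : Function.Injective i := by
    rintro p q e
    have a := i0 p
    have b := i1 p
    rw [e, i0] at a
    rw [e, i1] at b
    obtain ⟨⟨k, n⟩, h, h'⟩ := p
    obtain ⟨⟨k', n'⟩, g, g'⟩ := q
    simp only at a b h g
    simp only [Subtype.mk.injEq, Prod.mk.injEq]
    omega
  rw [← hinj.hasSum_iff]
  · refine h1.hasSum.congr_fun fun p => ?_
    have hp := p.2
    show weightedSeries (i p) * monomialValue x y (i p) = _
    rw [weightedSeries, monomialValue, i0, i1, if_pos ⟨by omega, hp.2⟩,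
      Nat.sub_add_cancel hp.1.le]
    ring
  · intro d hd
    show weightedSeries d * monomialValue x y d = 0
    rw [weightedSeries, if_neg, zero_mul]
    rintro ⟨h0, h1⟩
    refine hd ⟨⟨(d 0 + d 1, d 1), by simp; omega⟩, ?_⟩
    ext j
    fin_cases j
    · show d 0 + d 1 - d 1 = d 0
      omega
    · rfl

/-- The zeros accumulate at the origin, so the analytic sum vanishes near it and its expansion is
trivial. -/
theorem eq_zero_of_hasSum_zero {c : ℕ → ℝ} {r : ℝ} (hr : 0 < r)
    (h : ∀ t ∈ Set.Ioo 0 r, HasSum (fun n => c n * t ^ n) 0) : c = 0 := by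
  set p := FormalMultilinearSeries.ofScalars ℝ c with hp
  have hrad : 0 < p.radius := by
    have h1 := (h (r / 2) ⟨by linarith, by linarith⟩).summable.norm
    set ρ : NNReal := ⟨r / 2, by linarith⟩ with hρ
    have h2 : (ρ : ENNReal) ≤ p.radius := by
      refine p.le_radius_of_summable (h1.congr fun n => ?_)
      rw [norm_mul, norm_pow, hp, FormalMultilinearSeries.ofScalars_norm,
        Real.norm_of_nonneg (by linarith : 0 ≤ r / 2)]
      rfl
    refine lt_of_lt_of_le ?_ h2
    rw [ENNReal.coe_pos]
    exact (by linarith : 0 < r / 2)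
  have hball := p.hasFPowerSeriesOnBall hrad
  have hzero : ∀ t ∈ Set.Ioo 0 r, p.sum t = 0 := fun t ht => by
    rw [← (h t ht).tsum_eq, FormalMultilinearSeries.sum]
    refine tsum_congr fun n => ?_
    rw [hp, FormalMultilinearSeries.ofScalars_apply_eq, smul_eq_mul]
  have hfreq : ∃ᶠ z in nhdsWithin 0 {0}ᶜ, p.sum z = 0 := by
    have : ∃ᶠ z in nhdsWithin (0 : ℝ) (Set.Ioi 0), p.sum z = 0 :=
      Filter.Eventually.frequently (by
        filter_upwards [Ioo_mem_nhdsGT hr] with t ht using hzero t ht)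
    exact this.filter_mono (nhdsWithin_mono _ fun z hz => ne_of_gt hz)
  have hev := hball.analyticAt.frequently_zero_iff_eventually_zero.mp hfreq
  have hp0 : p = 0 := (hball.hasFPowerSeriesAt.congr hev).eq_zero
  exact (FormalMultilinearSeries.ofScalars_series_eq_zero ℝ).mp hp0

/-- Exponents of monomials in two variables. -/
noncomputable def exponentEquiv : ℕ × ℕ ≃ (Fin 2 →₀ ℕ) :=
  (finTwoArrowEquiv ℕ).symm.trans Finsupp.equivFunOnFinite.symm

/-- The one-variable statement is applied twice: in `x` for fixed `y`, then in `y` to each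
coefficient series. -/
theorem mvPowerSeries_eq_zero {F : MvPowerSeries (Fin 2) ℝ} {r s : ℝ} (hr : 0 < r) (hs : 0 < s)
    (h : ∀ x ∈ Set.Ioo 0 r, ∀ y ∈ Set.Ioo 0 s, HasSum (seriesTerm x y F) 0) : F = 0 := by
  set c : ℕ → ℕ → ℝ := fun a b => MvPowerSeries.coeff (exponentEquiv (a, b)) F with hc
  have h1 (x) (hx : x ∈ Set.Ioo 0 r) (y) (hy : y ∈ Set.Ioo 0 s) :
      HasSum (fun p : ℕ × ℕ => c p.1 p.2 * (x ^ p.1 * y ^ p.2)) 0 :=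
    exponentEquiv.hasSum_iff.mpr (h x hx y hy)
  have h2 (y) (hy : y ∈ Set.Ioo 0 s) (a : ℕ) : Summable fun b => c a b * y ^ b := by
    have hx : r / 2 ∈ Set.Ioo 0 r := ⟨by linarith, by linarith⟩
    have h3 := (h1 _ hx y hy).summable.prod_factor a
    have hne : (r / 2) ^ a ≠ 0 := by positivity
    rw [← summable_mul_left_iff hne]
    exact h3.congr fun b => by ring
  have h4 (y) (hy : y ∈ Set.Ioo 0 s) : (fun a => ∑' b, c a b * y ^ b) = 0 := by
    refine eq_zero_of_hasSum_zero hr fun x hx => ?_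
    refine (h1 x hx y hy).prod_fiberwise fun a => ?_
    refine ((h2 y hy a).hasSum.mul_right (x ^ a)).congr_fun fun b => ?_
    ring
  have h5 (a : ℕ) : c a = 0 := eq_zero_of_hasSum_zero hs fun y hy => by
    have h6 := (h2 y hy a).hasSum
    rwa [congrFun (h4 y hy) a] at h6
  ext d
  obtain ⟨⟨a, b⟩, rfl⟩ := exponentEquiv.surjective d
  exact congrFun (h5 a) b

theorem one_sub_weightedSeries :
    1 - weightedSeries = (PowerSeries.exp ℝ).subst exponentSeries := by
  rw [← sub_eq_zero]
  refine mvPowerSeries_eq_zero (r := 1 / 2) (s := 1 / 4) (by norm_num) (by norm_num)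
    fun x hx y hy => ?_
  have hx' : |x| < 1 / 2 := by rw [abs_of_pos hx.1]; exact hx.2
  have hy' : |y| < 1 / 4 := by rw [abs_of_pos hy.1]; exact hy.2
  have e1 := hasSum_exp_exponentSeries hx.1.le hy.1.le (by linarith [hx.2, hy.2])
  have e2 := hasSum_weightedSeries hx'.le hy'.le
  have e3 : HasSum (seriesTerm x y 1) 1 := by
    simpa using (hasSum_seriesTerm_pow e2 le_rfl 0).1
  have key := one_sub_tsum_weightedSum (x := x) (y := y) (by simpa using hx') (by simpa using hy')
  rw [← exponent_ofReal, ← Complex.ofReal_exp] at key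
  have e4 : 1 - (∑' p : {p : ℕ × ℕ // p.2 < p.1 ∧ 1 ≤ p.2},
        weightedSum p.1.1 p.1.2 * x ^ (p.1.1 - p.1.2) * y ^ p.1.2) =
      Real.exp (∑' k, PowerSeries.coeff k depthOneSeries * (x ^ k + y ^ k - (x + y) ^ k)) := by
    apply Complex.ofReal_injective
    rw [← key]
    push_cast
    rfl
  have e5 := (e3.sub e2).sub e1
  rw [e4, sub_self] at e5
  refine e5.congr_fun fun d => ?_
  simp only [seriesTerm, map_sub]
  ring

end MultipleT

theorem theorem1p1 :
    (∀ (n : ℕ) (κ : Fin n → ℕ), MultipleT.IsIndex κ → MultipleT.IsAdmissible κ →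
      Summable fun m : MultipleT.SumRange n => MultipleT.term κ m) ∧
    1 - MultipleT.weightedSeries = (PowerSeries.exp ℝ).subst MultipleT.exponentSeries ∧
    ∀ x y : ℂ, ‖x‖ < 1 / 2 → ‖y‖ < 1 / 4 →
      Summable (fun p : {p : ℕ × ℕ // p.2 < p.1 ∧ 1 ≤ p.2} =>
        (MultipleT.weightedSum p.1.1 p.1.2 : ℂ) * x ^ (p.1.1 - p.1.2) * y ^ p.1.2) ∧
      Summable (fun n : {n : ℕ // 2 ≤ n} =>
        (MultipleT.T ![n.1] : ℂ) / (2 * (n.1 : ℂ)) *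
          (x ^ n.1 + y ^ n.1 - (x + y) ^ n.1)) ∧
      1 - ∑' p : {p : ℕ × ℕ // p.2 < p.1 ∧ 1 ≤ p.2},
          (MultipleT.weightedSum p.1.1 p.1.2 : ℂ) * x ^ (p.1.1 - p.1.2) * y ^ p.1.2
        = Complex.exp (∑' n : {n : ℕ // 2 ≤ n},
            (MultipleT.T ![n.1] : ℂ) / (2 * (n.1 : ℂ)) *
              (x ^ n.1 + y ^ n.1 - (x + y) ^ n.1)) :=
  ⟨fun _ _ => MultipleT.summable_term, MultipleT.one_sub_weightedSeries, fun _ _ hx hy =>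
    ⟨(MultipleT.hasSum_weightedSum hx.le hy.le).summable, MultipleT.summable_exponent hx hy,
      MultipleT.one_sub_tsum_weightedSum hx hy⟩⟩
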